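/- Let $\mathfrak F$ be $\mathbb R$, $\mathbb C$ or the quaternions $\mathbb H$, with conjugation and norm as usual, and let $\beta=\dim_{\mathbb R}\mathfrak F\in\{1,2,4\}$. For a matrix $A$ over $\mathfrak F$ let $A^*$ be its conjugate transpose and $\operatorname{etr}(A)=\exp(\operatorname{Re}\operatorname{tr}A)$. Let $\mathfrak P_n^\beta$ be the cone of positive definite Hermitian $n\times n$ matrices over $\mathfrak F$, and for $A\in\mathfrak P_n^\beta$ let $|A|>0$ be its determinant (the product of its eigenvalues; equivalently, $|A|^\beta$ is the determinant of the real linear map $x\mapsto Ax$ on $\mathfrak F^n$). Let $(dX)$ be Lebesgue measure on $\mathfrak F^{m\times n}$ in the $\beta mn$ real coordinates, and $(dS)$ Lebesgue measure on the Hermitian matrices in the real diagonal entries and the real coordinates of the entries above the diagonal. Put $$\Gamma_n^\beta[a]=\int_{\mathfrak P_n^\beta}\operatorname{etr}(-A)\,|A|^{a-(n-1)\beta/2-1}(dA),\qquad a>(n-1)\beta/2 .$$ Define the following laws. * $\mathcal N_{m\times n}^\beta(M,A\otimes B)$, for $M\in\mathfrak F^{m\times n}$, $A\in\mathfrak P_m^\beta$,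 $B\in\mathfrak P_n^\beta$, has density with respect to $(dY)$ $$\frac{\operatorname{etr}\{-\tfrac{\beta}{2}A^{-1}(Y-M)B^{-1}(Y-M)^*\}}{(2\pi/\beta)^{\beta mn/2}|A|^{\beta n/2}|B|^{\beta m/2}} .$$ * $\mathcal W_n^\beta(N,S)$, for $N>n-1$ and $S\in\mathfrak P_n^\beta$, has density with respect to $(dV)$ on $\mathfrak P_n^\beta$ $$\frac{|V|^{\beta(N-n+1)/2-1}\operatorname{etr}\{-\tfrac{\beta}{2}S^{-1}V\}}{(2/\beta)^{\beta nN/2}\,\Gamma_n^\beta[\beta N/2]\,|S|^{\beta N/2}} .$$ * $\mathcal T_{m\times n}^\beta(\nu,\mu,\Xi,\Sigma)$, for $\nu>m-1$, $\mu\in\mathfrak F^{m\times n}$, $\Xi\in\mathfrak P_m^\beta$, $\Sigma\in\mathfrak P_n^\beta$, has density with respect to $(dT)$ $$\frac{\Gamma_m^\beta[\beta(n+\nu)/2]}{\pi^{mn\beta/2}\,\Gamma_m^\beta[\beta\nu/2]\,|\Xi|^{\beta\nu/2}|\Sigma|^{\beta m/2}}\;\bigl|\Xi^{-1}+(T-\mu)\Sigma^{-1}(T-\mu)^*\bigr|^{-\beta(n+\nu)/2}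 .$$ Let $\nu>m-1$ be real, $\mu\in\mathfrak F^{m\times n}$, $\Xi\in\mathfrak P_m^\beta$ and $\Sigma\in\mathfrak P_n^\beta$. Let $X\sim\mathcal N_{m\times n}^\beta(0,\Xi^{-1}\otimes I_n)$ and $U\sim\mathcal W_n^\beta(\nu+n-m,\Sigma^{-1})$ be random matrices on one probability space, and let $L_1$ be any random $n\times n$ matrix over $\mathfrak F$ that is a square root of $U$, in the sense that $L_1L_1^*=U$ almost surely, and that is independent of $X$ (for example, $U$ is independent of $X$ and $L_1$ is a measurable function of $U$). Then $$T=XL_1^{-1}+\mu\;\sim\;\mathcal T_{m\times n}^\beta(\nu,\mu,\Xi,\Sigma).$$ -/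

import Mathlib

open MeasureTheory ProbabilityTheory

open scoped Matrix

noncomputable section

namespace NDA

/-- `F` is an (associative) real normed division algebra with its conjugation `star`: the norm is
multiplicative (`NormedDivisionRing`), Euclidean (`InnerProductSpace`), multiplication is real
bilinear and `star a * a = ‖a‖²`. In finite dimension these are exactly `ℝ`, `ℂ` and the
quaternions, see the three instances below. -/
class RealNormedDivisionAlgebra (F : Type*) [NormedDivisionRing F] [StarRing F]
    [InnerProductSpace ℝ F] : Prop where
  smul_mul (r : ℝ) (a b : F) : (r • a) * b = r • (a * b)
  mul_smul (r : ℝ) (a b : F) : a * (r • b) = r • (a * b)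
  star_mul_self (a : F) : star a * a = (‖a‖ ^ 2) • (1 : F)

instance : RealNormedDivisionAlgebra ℝ where
  smul_mul r a b := by simp [mul_assoc]
  mul_smul r a b := by simp [mul_left_comm]
  star_mul_self a := by simp [sq]

instance : RealNormedDivisionAlgebra ℂ where
  smul_mul r a b := by simp [mul_assoc]
  mul_smul r a b := by simp [mul_left_comm]
  star_mul_self a := by
    rw [Complex.star_def, ← Complex.normSq_eq_conj_mul_self, Complex.normSq_eq_norm_sq]
    simp

instance : RealNormedDivisionAlgebra (Quaternion ℝ) where
  smul_mul r a b := by simp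
  mul_smul r a b := by simp
  star_mul_self a := by
    rw [Quaternion.star_mul_self, Quaternion.normSq_eq_norm_mul_self, ← sq,
      ← Algebra.algebraMap_eq_smul_one]
    rfl

instance matrixMeasurableSpace {m n F : Type*} [MeasurableSpace F] :
    MeasurableSpace (Matrix m n F) :=
  inferInstanceAs (MeasurableSpace (m → n → F))

section Algebra

variable (F : Type*) [NormedDivisionRing F] [StarRing F] [InnerProductSpace ℝ F]

/-- The real dimension `β` of `F`, as a real number. -/
def rdim : ℝ := (Module.finrank ℝ F : ℝ)

variable {F}

/-- The real part of the trace; `etr A = exp (retr A)`. -/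
def retr {n : ℕ} (A : Matrix (Fin n) (Fin n) F) : ℝ := inner ℝ (1 : F) A.trace

/-- The cone of positive definite Hermitian matrices over `F`. -/
def IsPosDef {n : ℕ} (A : Matrix (Fin n) (Fin n) F) : Prop :=
  A.IsHermitian ∧ ∀ x : Fin n → F, x ≠ 0 → 0 < inner ℝ (1 : F) (star x ⬝ᵥ (A *ᵥ x))

variable [RealNormedDivisionAlgebra F]

/-- The real linear endomorphism `x ↦ A x` of `Fⁿ`. -/
def realLin {n : ℕ} (A : Matrix (Fin n) (Fin n) F) : (Fin n → F) →ₗ[ℝ] (Fin n → F) where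
  toFun x := A *ᵥ x
  map_add' x y := Matrix.mulVec_add A x y
  map_smul' r x := by
    funext i
    simp [Matrix.mulVec, dotProduct, Finset.smul_sum, RealNormedDivisionAlgebra.mul_smul]

/-- The determinant `|A|` of a positive definite matrix over `F` (more generally, the absolute
value of the determinant): the real determinant of `x ↦ A x` on `Fⁿ` is `|A| ^ β`. Over `ℝ` and `ℂ`
this is the modulus of the usual determinant, over the quaternions it is the normalized Dieudonné
determinant (the square root of the Study determinant), which on positive definite matrices is
the Moore determinant, the product of the eigenvalues. -/
def detF {n : ℕ} (A : Matrix (Fin n) (Fin n) F) : ℝ :=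
  |LinearMap.det (realLin A)| ^ (1 / rdim F)

end Algebra

section Measures

variable (F : Type*) [NormedDivisionRing F] [StarRing F] [InnerProductSpace ℝ F]
  [FiniteDimensional ℝ F] [MeasurableSpace F] [BorelSpace F]

/-- Lebesgue measure `(dX)` on the `m × n` matrices over `F`. -/
def matVolume (m n : ℕ) : Measure (Matrix (Fin m) (Fin n) F) :=
  Measure.pi fun _ : Fin m => Measure.pi fun _ : Fin n => (volume : Measure F)

variable {F}

/-- The Hermitian matrix with real diagonal `d` and entries `z` above the diagonal. -/
def hermOf {n : ℕ} (p : (Fin n → ℝ) × ({q : Fin n × Fin n // q.1 < q.2} → F)) :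
    Matrix (Fin n) (Fin n) F :=
  fun i j =>
    if h : i < j then p.2 ⟨(i, j), h⟩
    else if h : j < i then star (p.2 ⟨(j, i), h⟩)
    else p.1 i • (1 : F)

variable (F)

/-- Lebesgue measure `(dS)` on the Hermitian matrices: the product of the Lebesgue measures of the
real diagonal entries and of the entries above the diagonal. -/
def hermVolume (n : ℕ) : Measure (Matrix (Fin n) (Fin n) F) :=
  ((Measure.pi fun _ : Fin n => (volume : Measure ℝ)).prod
    (Measure.pi fun _ : {q : Fin n × Fin n // q.1 < q.2} => (volume : Measure F))).map hermOf

variable [RealNormedDivisionAlgebra F]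

/-- The multivariate Gamma function `Γ_n^β[a]`. -/
def mvGamma (n : ℕ) (a : ℝ) : ℝ :=
  ∫ A in {A : Matrix (Fin n) (Fin n) F | IsPosDef A},
    Real.exp (-retr A) * detF A ^ (a - ((n : ℝ) - 1) * rdim F / 2 - 1) ∂(hermVolume F n)

variable {F}

/-- The matrix normal law `N_{m×n}^β(M, A ⊗ B)`. -/
def matrixNormal {m n : ℕ} (M : Matrix (Fin m) (Fin n) F) (A : Matrix (Fin m) (Fin m) F)
    (B : Matrix (Fin n) (Fin n) F) : Measure (Matrix (Fin m) (Fin n) F) :=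
  (matVolume F m n).withDensity fun Y => ENNReal.ofReal
    (1 / ((2 * Real.pi / rdim F) ^ (rdim F * m * n / 2)
        * detF A ^ (rdim F * n / 2) * detF B ^ (rdim F * m / 2))
      * Real.exp (-(rdim F / 2 *
          retr (Ring.inverse A * (Y - M) * Ring.inverse B * (Y - M)ᴴ))))

/-- The Wishart law `W_n^β(N, S)`, supported on the positive definite matrices. -/
def wishart {n : ℕ} (N : ℝ) (S : Matrix (Fin n) (Fin n) F) : Measure (Matrix (Fin n) (Fin n) F) :=
  ((hermVolume F n).restrict {V | IsPosDef V}).withDensity fun V => ENNReal.ofReal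
    (1 / ((2 / rdim F) ^ (rdim F * n * N / 2) * mvGamma F n (rdim F * N / 2)
        * detF S ^ (rdim F * N / 2))
      * detF V ^ (rdim F * (N - n + 1) / 2 - 1)
      * Real.exp (-(rdim F / 2 * retr (Ring.inverse S * V))))

/-- The matricvariate `T` law `T_{m×n}^β(ν, μ, Ξ, S)`. -/
def matricvariateT {m n : ℕ} (ν : ℝ) (μ : Matrix (Fin m) (Fin n) F)
    (Ξ : Matrix (Fin m) (Fin m) F) (S : Matrix (Fin n) (Fin n) F) :
    Measure (Matrix (Fin m) (Fin n) F) :=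
  (matVolume F m n).withDensity fun T => ENNReal.ofReal
    (mvGamma F m (rdim F * (n + ν) / 2)
        / (Real.pi ^ (m * n * rdim F / 2) * mvGamma F m (rdim F * ν / 2)
          * detF Ξ ^ (rdim F * ν / 2) * detF S ^ (rdim F * m / 2))
      * detF (Ring.inverse Ξ + (T - μ) * Ring.inverse S * (T - μ)ᴴ) ^ (-(rdim F * (n + ν) / 2)))

end Measures

end NDA

end

/-!
Given `L₁`, the matrix `X L₁⁻¹ + μ` is normal with column covariance `U⁻¹`, so its law is a mixture
of normal laws over the Wishart law of `U`. Integrating out `V = U` in the joint density uses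
`∫ etr(-A V) |V| ^ a dκ(V) = |A| ^ (-a) Γ[a]`, where `κ` is the invariant measure on the cone of
positive definite matrices, and leaves a constant times
`|Σ + (T - μ)ᴴ Ξ (T - μ)| ^ (-β (n + ν) / 2)`; the identity `|1 + A B| = |1 + B A|` turns this into
the `T` density. The constant needs no computation, because both laws have total mass one.

The invariance of `κ` amounts to the Jacobian of `V ↦ u V uᴴ` being `|u| ^ (β (n - 1) + 2)`. Both
are characters of `GLₙ(F)`, hence trivial on commutators, in particular on transvections; since
transvections and real diagonal matrices suffice to reduce a positive definite matrix to `1`, only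
real diagonal `u` have to be checked.

That the `T` density has mass one follows by integrating `etr(-(M + T N Tᴴ) V) |V| ^ a` over `V` and
`T` in both orders, once `Γ[a]` is known to be finite. For this the same computation with a single
column `T` relates `Γ[a + β / 2]` to `Γ[a]`, and `a = (n - 1) β / 2 + 1`, where the power of `|V|`
is absent, is elementary.
-/

noncomputable section

namespace NDA

section Scalars

variable {F : Type*} [NormedDivisionRing F] [InnerProductSpace ℝ F]

theorem inner_one_one : inner ℝ (1 : F) 1 = 1 := by
  simp

variable (F) in
theorem rdim_pos [FiniteDimensional ℝ F] : 0 < rdim F := by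
  unfold rdim
  exact_mod_cast Module.finrank_pos

variable [StarRing F] [RealNormedDivisionAlgebra F]

instance : IsScalarTower ℝ F F := ⟨fun r a b => RealNormedDivisionAlgebra.smul_mul r a b⟩

instance : SMulCommClass ℝ F F := ⟨fun r a b => (RealNormedDivisionAlgebra.mul_smul r a b).symm⟩

theorem star_mul_add_star_mul (a b : F) :
    star a * b + star b * a = (2 * inner ℝ a b) • (1 : F) := by
  have h := RealNormedDivisionAlgebra.star_mul_self (a + b)
  rw [norm_add_sq_real, star_add, add_mul, mul_add, mul_add,
    RealNormedDivisionAlgebra.star_mul_self a, RealNormedDivisionAlgebra.star_mul_self b,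
    add_smul, add_smul] at h
  rw [← sub_eq_zero] at h ⊢
  rw [← h]
  abel

theorem star_eq_two_inner_one_smul_sub (a : F) :
    star a = (2 * inner ℝ (1 : F) a) • (1 : F) - a := by
  rw [eq_sub_iff_add_eq, ← star_mul_add_star_mul, star_one, one_mul, mul_one, add_comm]

instance : StarModule ℝ F where
  star_smul r a := by
    rw [star_eq_two_inner_one_smul_sub, star_eq_two_inner_one_smul_sub a, inner_smul_right,
      smul_sub, smul_smul, star_trivial, mul_left_comm]

theorem inner_star_star (a b : F) : inner ℝ (star a) (star b) = inner ℝ a b := by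
  rw [star_eq_two_inner_one_smul_sub, star_eq_two_inner_one_smul_sub b]
  simp only [inner_sub_left, inner_sub_right, inner_smul_left, inner_smul_right, inner_one_one,
    real_inner_comm (1 : F) a, conj_trivial]
  ring

theorem inner_one_star (a : F) : inner ℝ (1 : F) (star a) = inner ℝ (1 : F) a := by
  simpa only [star_one] using inner_star_star (1 : F) a

instance : NormedStarGroup F where
  norm_star_le a := by
    rw [norm_eq_sqrt_real_inner, norm_eq_sqrt_real_inner, inner_star_star]

theorem inner_eq_inner_one_star_mul (a b : F) : inner ℝ a b = inner ℝ (1 : F) (star a * b) := by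
  have h := congrArg (inner ℝ (1 : F)) (star_mul_add_star_mul a b)
  rw [inner_add_right, ← inner_one_star (star b * a), star_mul, star_star, inner_smul_right,
    inner_one_one] at h
  linarith

theorem inner_mul_left_eq_inner_star_mul (a b c : F) :
    inner ℝ (a * b) c = inner ℝ b (star a * c) := by
  rw [inner_eq_inner_one_star_mul, inner_eq_inner_one_star_mul b, star_mul, mul_assoc]

theorem inner_one_mul_comm (a b : F) : inner ℝ (1 : F) (a * b) = inner ℝ (1 : F) (b * a) := by
  rw [← star_star a, ← inner_eq_inner_one_star_mul, real_inner_comm, ← inner_star_star,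
    star_star, inner_eq_inner_one_star_mul, star_star]

theorem mul_star_self_eq_norm_sq_smul_one (a : F) : a * star a = (‖a‖ ^ 2) • (1 : F) := by
  simpa only [star_star, norm_star] using RealNormedDivisionAlgebra.star_mul_self (star a)

theorem eq_smul_one_of_star_eq {a : F} (h : star a = a) : a = (inner ℝ (1 : F) a) • (1 : F) := by
  have two_smul_eq : (2 : ℝ) • a = (2 : ℝ) • ((inner ℝ (1 : F) a) • (1 : F)) := by
    rw [smul_smul, two_smul, ← sub_eq_iff_eq_add.1 (h.symm.trans
      (star_eq_two_inner_one_smul_sub a)).symm]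
  exact smul_right_injective F (two_ne_zero : (2 : ℝ) ≠ 0) two_smul_eq

end Scalars

section TraceAndDeterminant

variable {F : Type*} [NormedDivisionRing F] [InnerProductSpace ℝ F]

theorem retr_eq_sum {n : ℕ} (A : Matrix (Fin n) (Fin n) F) :
    retr A = ∑ i, inner ℝ (1 : F) (A i i) := by
  simp [retr, Matrix.trace, inner_sum]

theorem retr_add {n : ℕ} (A B : Matrix (Fin n) (Fin n) F) : retr (A + B) = retr A + retr B := by
  simp [retr, inner_add_right]

theorem retr_smul {n : ℕ} (r : ℝ) (A : Matrix (Fin n) (Fin n) F) :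
    retr (r • A) = r * retr A := by
  simp [retr, inner_smul_right]

variable [StarRing F] [RealNormedDivisionAlgebra F]

theorem retr_mul_comm {m n : ℕ} (A : Matrix (Fin m) (Fin n) F) (B : Matrix (Fin n) (Fin m) F) :
    retr (A * B) = retr (B * A) := by
  simp only [retr_eq_sum, Matrix.mul_apply, inner_sum]
  rw [Finset.sum_comm]
  exact Finset.sum_congr rfl fun i _ => Finset.sum_congr rfl fun j _ => inner_one_mul_comm _ _

theorem retr_mul_conjTranspose_self {m n : ℕ} (A : Matrix (Fin m) (Fin n) F) :
    retr (A * Aᴴ) = ∑ i, ∑ j, ‖A i j‖ ^ 2 := by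
  simp only [retr_eq_sum, Matrix.mul_apply, inner_sum, Matrix.conjTranspose_apply,
    mul_star_self_eq_norm_sq_smul_one, inner_smul_right, inner_one_one, mul_one]

theorem sum_inner_conjTranspose_mulVec {m n : ℕ} (A : Matrix (Fin m) (Fin n) F)
    (x : Fin m → F) (y : Fin n → F) :
    ∑ i, inner ℝ ((Aᴴ *ᵥ x) i) (y i) = ∑ i, inner ℝ (x i) ((A *ᵥ y) i) := by
  simp only [Matrix.mulVec, dotProduct, inner_sum, sum_inner, Matrix.conjTranspose_apply,
    inner_mul_left_eq_inner_star_mul, star_star]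
  exact Finset.sum_comm

/-- The real linear map `x ↦ A x` of a rectangular matrix; `realLin` is the square case. -/
def rectLin {m n : ℕ} (A : Matrix (Fin m) (Fin n) F) : (Fin n → F) →ₗ[ℝ] (Fin m → F) where
  toFun x := A *ᵥ x
  map_add' x y := Matrix.mulVec_add A x y
  map_smul' r x := Matrix.mulVec_smul A r x

theorem realLin_one {n : ℕ} : realLin (1 : Matrix (Fin n) (Fin n) F) = LinearMap.id :=
  LinearMap.ext fun x => Matrix.one_mulVec x

theorem realLin_mul {n : ℕ} (A B : Matrix (Fin n) (Fin n) F) :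
    realLin (A * B) = realLin A ∘ₗ realLin B :=
  LinearMap.ext fun x => (Matrix.mulVec_mulVec x A B).symm

theorem realLin_one_add_mul {m n : ℕ} (A : Matrix (Fin m) (Fin n) F)
    (B : Matrix (Fin n) (Fin m) F) :
    realLin (1 + A * B) = LinearMap.id + rectLin A ∘ₗ rectLin B := by
  refine LinearMap.ext fun x => ?_
  change (1 + A * B) *ᵥ x = x + A *ᵥ (B *ᵥ x)
  rw [Matrix.add_mulVec, Matrix.one_mulVec, Matrix.mulVec_mulVec]

theorem detF_nonneg {n : ℕ} (A : Matrix (Fin n) (Fin n) F) : 0 ≤ detF A :=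
  Real.rpow_nonneg (abs_nonneg _) _

theorem detF_mul {n : ℕ} (A B : Matrix (Fin n) (Fin n) F) : detF (A * B) = detF A * detF B := by
  simp only [detF]
  rw [realLin_mul, LinearMap.det_comp, abs_mul, Real.mul_rpow (abs_nonneg _) (abs_nonneg _)]

theorem detF_one {n : ℕ} : detF (1 : Matrix (Fin n) (Fin n) F) = 1 := by
  simp [detF, realLin_one]

theorem detF_pos_of_isUnit {n : ℕ} {A : Matrix (Fin n) (Fin n) F} (h : IsUnit A) : 0 < detF A := by
  refine (detF_nonneg A).lt_of_ne' fun h0 => one_ne_zero (α := ℝ) ?_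
  rw [← detF_one (F := F) (n := n), ← Ring.mul_inverse_cancel A h, detF_mul, h0, zero_mul]

theorem detF_inverse {n : ℕ} {A : Matrix (Fin n) (Fin n) F} (h : IsUnit A) :
    detF (Ring.inverse A) = (detF A)⁻¹ := by
  rw [← mul_eq_one_iff_eq_inv₀ (detF_pos_of_isUnit h).ne', ← detF_mul, Ring.inverse_mul_cancel _ h,
    detF_one]

variable [FiniteDimensional ℝ F]

theorem detF_rpow_rdim {n : ℕ} (A : Matrix (Fin n) (Fin n) F) :
    detF A ^ rdim F = |LinearMap.det (realLin A)| := by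
  rw [detF, ← Real.rpow_mul (abs_nonneg _), one_div_mul_cancel (rdim_pos F).ne', Real.rpow_one]

theorem det_id_add_comp_comm {K V W : Type*} [Field K] [AddCommGroup V] [Module K V]
    [FiniteDimensional K V] [AddCommGroup W] [Module K W] [FiniteDimensional K W]
    (f : V →ₗ[K] W) (g : W →ₗ[K] V) :
    LinearMap.det (LinearMap.id + g ∘ₗ f) = LinearMap.det (LinearMap.id + f ∘ₗ g) := by
  let b := Module.finBasis K V
  let c := Module.finBasis K W
  rw [← LinearMap.det_toMatrix b, ← LinearMap.det_toMatrix c, map_add, map_add,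
    LinearMap.toMatrix_id, LinearMap.toMatrix_id, LinearMap.toMatrix_comp b c b,
    LinearMap.toMatrix_comp c b c, Matrix.det_one_add_mul_comm]

theorem detF_one_add_mul_comm {m n : ℕ} (A : Matrix (Fin m) (Fin n) F)
    (B : Matrix (Fin n) (Fin m) F) : detF (1 + A * B) = detF (1 + B * A) := by
  rw [detF, detF, realLin_one_add_mul, realLin_one_add_mul, det_id_add_comp_comm]

theorem det_adjoint {𝕜 V : Type*} [RCLike 𝕜] [NormedAddCommGroup V] [InnerProductSpace 𝕜 V]
    [FiniteDimensional 𝕜 V] (f : V →ₗ[𝕜] V) :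
    LinearMap.det (LinearMap.adjoint f) = star (LinearMap.det f) := by
  let b := stdOrthonormalBasis 𝕜 V
  rw [← LinearMap.det_toMatrix b.toBasis, ← LinearMap.det_toMatrix b.toBasis,
    LinearMap.toMatrix_adjoint, Matrix.det_conjTranspose]

theorem detF_conjTranspose {n : ℕ} (A : Matrix (Fin n) (Fin n) F) : detF Aᴴ = detF A := by
  let e : (Fin n → F) ≃ₗ[ℝ] PiLp 2 fun _ : Fin n => F := (WithLp.linearEquiv 2 ℝ (Fin n → F)).symm
  have adjoint_conj : LinearMap.adjoint (e.conj (realLin A)) = e.conj (realLin Aᴴ) := by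
    refine ((LinearMap.eq_adjoint_iff _ _).2 fun x y => ?_).symm
    simp only [PiLp.inner_apply]
    exact sum_inner_conjTranspose_mulVec A x.ofLp y.ofLp
  rw [detF, detF, ← LinearMap.det_conj (realLin A) e, ← LinearMap.det_conj (realLin Aᴴ) e]
  change |LinearMap.det (e.conj (realLin Aᴴ))| ^ _ = |LinearMap.det (e.conj (realLin A))| ^ _
  rw [← adjoint_conj, det_adjoint, star_trivial]

end TraceAndDeterminant

section PositiveDefinite

variable {F : Type*} [NormedDivisionRing F] [StarRing F] {n : ℕ}

theorem star_dotProduct_conj_mulVec {m : ℕ} (T : Matrix (Fin m) (Fin n) F)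
    (B : Matrix (Fin m) (Fin m) F) (x : Fin n → F) :
    star x ⬝ᵥ ((Tᴴ * B * T) *ᵥ x) = star (T *ᵥ x) ⬝ᵥ (B *ᵥ (T *ᵥ x)) := by
  rw [Matrix.star_mulVec, ← Matrix.dotProduct_mulVec, Matrix.mulVec_mulVec, Matrix.mulVec_mulVec,
    Matrix.mul_assoc]

variable [InnerProductSpace ℝ F]

theorem IsPosDef.conj {A : Matrix (Fin n) (Fin n) F} (hA : IsPosDef A)
    (u : (Matrix (Fin n) (Fin n) F)ˣ) : IsPosDef (u.valᴴ * A * u.val) := by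
  refine ⟨Matrix.isHermitian_conjTranspose_mul_mul _ hA.1, fun x hx => ?_⟩
  rw [star_dotProduct_conj_mulVec]
  refine hA.2 _ fun hux => hx ?_
  rw [← Matrix.one_mulVec x, ← u.inv_mul, ← Matrix.mulVec_mulVec, hux, Matrix.mulVec_zero]

theorem IsPosDef.add_conj {m : ℕ} {A : Matrix (Fin n) (Fin n) F} (hA : IsPosDef A)
    {B : Matrix (Fin m) (Fin m) F} (hB : IsPosDef B) (T : Matrix (Fin m) (Fin n) F) :
    IsPosDef (A + Tᴴ * B * T) := by
  refine ⟨hA.1.add (Matrix.isHermitian_conjTranspose_mul_mul _ hB.1), fun x hx => ?_⟩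
  rw [Matrix.add_mulVec, dotProduct_add, inner_add_right, star_dotProduct_conj_mulVec]
  refine add_pos_of_pos_of_nonneg (hA.2 x hx) ?_
  by_cases h0 : T *ᵥ x = 0
  · simp [h0]
  · exact (hB.2 _ h0).le

theorem IsPosDef.diag_pos {A : Matrix (Fin n) (Fin n) F} (hA : IsPosDef A) (k : Fin n) :
    0 < inner ℝ (1 : F) (A k k) := by
  have h := hA.2 (Pi.single k 1) (by simp)
  simpa [← Pi.single_star] using h

variable [RealNormedDivisionAlgebra F]

theorem isPosDef_one : IsPosDef (1 : Matrix (Fin n) (Fin n) F) := by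
  refine ⟨Matrix.isHermitian_one, fun x hx => ?_⟩
  rw [Matrix.one_mulVec, dotProduct, inner_sum]
  simp only [Pi.star_apply, ← inner_eq_inner_one_star_mul, real_inner_self_eq_norm_sq]
  obtain ⟨i, hi⟩ := Function.ne_iff.1 hx
  exact Finset.sum_pos' (fun i _ => by positivity)
    ⟨i, Finset.mem_univ _, pow_pos (norm_pos_iff.2 hi) 2⟩

theorem isPosDef_conjTranspose_mul_self (u : (Matrix (Fin n) (Fin n) F)ˣ) :
    IsPosDef (u.valᴴ * u.val) := by
  simpa only [Matrix.mul_one] using isPosDef_one.conj u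

theorem IsPosDef.smul {A : Matrix (Fin n) (Fin n) F} (hA : IsPosDef A) {r : ℝ} (hr : 0 < r) :
    IsPosDef (r • A) := by
  refine ⟨?_, fun x hx => ?_⟩
  · rw [Matrix.IsHermitian, Matrix.conjTranspose_smul, hA.1.eq, star_trivial]
  · rw [Matrix.smul_mulVec, dotProduct_smul, inner_smul_right]
    exact mul_pos hr (hA.2 x hx)

theorem diag_eq_smul_one_of_isHermitian {A : Matrix (Fin n) (Fin n) F} (hA : A.IsHermitian)
    (k : Fin n) : A k k = (inner ℝ (1 : F) (A k k)) • (1 : F) :=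
  eq_smul_one_of_star_eq (hA.apply k k)

end PositiveDefinite

section Elimination

variable {F : Type*} [NormedDivisionRing F] {n : ℕ}

/-- The elementary matrix `1 + eₖ cᵀ` with `cₖ = 0`: left multiplication by it adds to row `k` a
combination of the other rows. -/
def rowTransvection (k : Fin n) (c : Fin n → F) (hc : c k = 0) :
    (Matrix (Fin n) (Fin n) F)ˣ where
  val := 1 + Matrix.vecMulVec (Pi.single k 1) c
  inv := 1 - Matrix.vecMulVec (Pi.single k 1) c
  val_inv := by simp [add_mul, mul_sub, Matrix.vecMulVec_mul_vecMulVec, hc]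
  inv_val := by simp [sub_mul, mul_add, Matrix.vecMulVec_mul_vecMulVec, hc]

theorem rowTransvection_mul_self (k : Fin n) (c : Fin n → F) (hc : c k = 0) :
    (rowTransvection k c hc * rowTransvection k c hc).val
      = 1 + 2 • Matrix.vecMulVec (Pi.single k 1) c := by
  simp [rowTransvection, add_mul, mul_add, Matrix.vecMulVec_mul_vecMulVec, hc, two_smul, add_assoc]

theorem conj_rowTransvection [StarRing F] {B : Matrix (Fin n) (Fin n) F} (hB : B.IsHermitian)
    {k : Fin n} (hk : B k k = 1) {c : Fin n → F} (hc : c k = 0) (hcB : c = Pi.single k 1 - B k) :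
    (rowTransvection k c hc).valᴴ * B * (rowTransvection k c hc).val
      = B - Matrix.vecMulVec (B.col k) (B k) + Matrix.single k k 1 := by
  let e : Fin n → F := Pi.single k 1
  have star_c : star c = e - B.col k := by
    rw [hcB, star_sub, ← Pi.single_star, star_one, show star (B k) = B.col k from
      funext fun i => hB.apply i k]
  have mul_eq : B * (rowTransvection k c hc).val = B + Matrix.vecMulVec (B.col k) c := by
    simp [rowTransvection, mul_add, Matrix.mul_vecMulVec]
  have row_eq : e ᵥ* (B + Matrix.vecMulVec (B.col k) c) = e := by
    ext j
    simp [e, Matrix.vecMulVec_apply, Matrix.add_apply, hk, hcB]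
  have conjTranspose_eq :
      (rowTransvection k c hc).valᴴ = 1 + Matrix.vecMulVec (e - B.col k) e := by
    simp [rowTransvection, Matrix.conjTranspose_vecMulVec, star_c, e]
  rw [Matrix.mul_assoc, mul_eq, conjTranspose_eq, add_mul, one_mul, Matrix.vecMulVec_mul, row_eq,
    hcB, Matrix.vecMulVec_sub, Matrix.sub_vecMulVec, Matrix.single_eq_single_vecMulVec_single]
  abel

theorem exists_conj_rowTransvection_col_eq [StarRing F] {B : Matrix (Fin n) (Fin n) F}
    (hB : B.IsHermitian) {k : Fin n} (hk : B k k = 1) : ∃ c hc,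
      ((rowTransvection k c hc).valᴴ * B * (rowTransvection k c hc).val).col k = Pi.single k 1 ∧
      ∀ j ≠ k, B.col j = Pi.single j 1 →
        ((rowTransvection k c hc).valᴴ * B * (rowTransvection k c hc).val).col j
          = Pi.single j 1 := by
  refine ⟨Pi.single k 1 - B k, by simp [hk], ?_⟩
  rw [conj_rowTransvection hB hk _ rfl]
  refine ⟨funext fun i => ?_, fun j hj hBj => funext fun i => ?_⟩
  · simp [Matrix.vecMulVec_apply, hk, Matrix.single_apply, Pi.single_apply, eq_comm]
  · have hBj' : ∀ i, B i j = (Pi.single j 1 : Fin n → F) i := congrFun hBj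
    simp [Matrix.vecMulVec_apply, hBj', hj.symm]

variable [InnerProductSpace ℝ F] [StarRing F] [RealNormedDivisionAlgebra F]

variable (F) in
/-- The invertible real diagonal matrix with nonzero entries `d`. -/
def diagUnit (d : Fin n → ℝ) (hd : ∀ i, d i ≠ 0) : (Matrix (Fin n) (Fin n) F)ˣ where
  val := Matrix.diagonal fun i => d i • (1 : F)
  inv := Matrix.diagonal fun i => (d i)⁻¹ • (1 : F)
  val_inv := by simp [Matrix.diagonal_mul_diagonal, smul_smul, hd]
  inv_val := by simp [Matrix.diagonal_mul_diagonal, smul_smul, hd]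

theorem conjTranspose_diagUnit (d : Fin n → ℝ) (hd : ∀ i, d i ≠ 0) :
    (diagUnit F d hd).valᴴ = (diagUnit F d hd).val := by
  simp only [diagUnit, Matrix.diagonal_conjTranspose]
  congr 1
  ext i
  simp

theorem diagUnit_mul_mul_diagUnit_apply (d : Fin n → ℝ) (hd : ∀ i, d i ≠ 0)
    (A : Matrix (Fin n) (Fin n) F) (i j : Fin n) :
    ((diagUnit F d hd).val * A * (diagUnit F d hd).val) i j = (d i * d j) • A i j := by
  simp [diagUnit, Matrix.mul_diagonal, Matrix.diagonal_mul, smul_smul, mul_comm]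

theorem exists_mul_mul_inv_mul_inv_eq_rowTransvection (k : Fin n) (c : Fin n → F)
    (hc : c k = 0) : ∃ D, D * rowTransvection k c hc * D⁻¹ * (rowTransvection k c hc)⁻¹
      = rowTransvection k c hc := by
  have hd : ∀ i, Function.update (1 : Fin n → ℝ) k 2 i ≠ 0 := fun i => by
    rw [Function.update_apply]; split_ifs <;> norm_num
  refine ⟨diagUnit F _ hd, ?_⟩
  rw [mul_inv_eq_iff_eq_mul, mul_inv_eq_iff_eq_mul]
  apply Units.ext
  rw [Units.val_mul, Units.val_mul (_ * _), rowTransvection_mul_self]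
  ext i j
  rcases eq_or_ne i k with hi | hi <;> rcases eq_or_ne j k with hj | hj <;>
    simp [diagUnit, rowTransvection, Matrix.vecMulVec_apply, Matrix.one_apply, hi, hj, hc,
      eq_comm (a := k) (b := j), Function.update_apply, two_smul, add_mul, mul_add]

theorem map_rowTransvection {M : Type*} [CommMonoid M] (φ : (Matrix (Fin n) (Fin n) F)ˣ →* M)
    (k : Fin n) (c : Fin n → F) (hc : c k = 0) : φ (rowTransvection k c hc) = 1 := by
  obtain ⟨D, hD⟩ := exists_mul_mul_inv_mul_inv_eq_rowTransvection k c hc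
  calc φ (rowTransvection k c hc)
      = φ D * φ D⁻¹ * (φ (rowTransvection k c hc) * φ (rowTransvection k c hc)⁻¹) := by
        rw [← mul_mul_mul_comm, ← map_mul, ← map_mul, ← map_mul, ← mul_assoc, hD]
    _ = 1 := by rw [← map_mul, ← map_mul, mul_inv_cancel, mul_inv_cancel, map_one, mul_one]

theorem IsPosDef.exists_conj_apply_self_eq_one {A : Matrix (Fin n) (Fin n) F} (hA : IsPosDef A)
    (k : Fin n) : ∃ d hd, ((diagUnit F d hd).valᴴ * A * (diagUnit F d hd).val) k k = 1 ∧
      ∀ j ≠ k, A.col j = Pi.single j 1 →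
        ((diagUnit F d hd).valᴴ * A * (diagUnit F d hd).val).col j = Pi.single j 1 := by
  set a := inner ℝ (1 : F) (A k k)
  have ha : 0 < a := hA.diag_pos k
  let d : Fin n → ℝ := Function.update 1 k (Real.sqrt a)⁻¹
  have hd : ∀ i, d i ≠ 0 := fun i => by
    simp only [d, Function.update_apply]
    split_ifs
    · positivity
    · exact one_ne_zero
  have hdk : d k * d k * a = 1 := by
    simp only [d, Function.update_self]
    rw [← mul_inv, Real.mul_self_sqrt ha.le, inv_mul_cancel₀ ha.ne']
  refine ⟨d, hd, ?_, fun j hj hAj => funext fun i => ?_⟩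
  · rw [conjTranspose_diagUnit, diagUnit_mul_mul_diagUnit_apply,
      diag_eq_smul_one_of_isHermitian hA.1, smul_smul, hdk, one_smul]
  · rw [Matrix.col_apply, conjTranspose_diagUnit, diagUnit_mul_mul_diagUnit_apply,
      ← Matrix.col_apply A, hAj]
    rcases eq_or_ne i j with rfl | hij
    · simp [d, hj]
    · simp [hij]

variable {H : Subgroup (Matrix (Fin n) (Fin n) F)ˣ}

/- Symmetric Gaussian elimination, clearing one column after the other. -/
theorem IsPosDef.exists_mem_conj_eq_one {A : Matrix (Fin n) (Fin n) F} (hA : IsPosDef A)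
    (hdiag : ∀ d hd, diagUnit F d hd ∈ H) (htrans : ∀ k c hc, rowTransvection k c hc ∈ H) :
    ∃ u ∈ H, u.valᴴ * A * u.val = 1 := by
  suffices h : ∀ s : Finset (Fin n), ∃ u ∈ H, ∀ j ∈ s,
      (u.valᴴ * A * u.val).col j = Pi.single j 1 by
    obtain ⟨u, hu, h⟩ := h Finset.univ
    refine ⟨u, hu, Matrix.ext_col fun j => (h j (Finset.mem_univ j)).trans (funext fun i => ?_)⟩
    simp [Matrix.one_apply, Pi.single_apply]
  intro s
  induction s using Finset.induction_on with
  | empty => exact ⟨1, one_mem H, by simp⟩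
  | insert k s _ ih =>
    obtain ⟨u, hu, hs⟩ := ih
    obtain ⟨d, hd, hk, hsD⟩ := (hA.conj u).exists_conj_apply_self_eq_one k
    obtain ⟨c, hc, hkC, hsC⟩ := exists_conj_rowTransvection_col_eq ((hA.conj u).conj _).1 hk
    refine ⟨u * diagUnit F d hd * rowTransvection k c hc,
      mul_mem (mul_mem hu (hdiag d hd)) (htrans k c hc), fun j hj => ?_⟩
    have conj_eq : ∀ C D : (Matrix (Fin n) (Fin n) F)ˣ, (u * D * C).valᴴ * A * (u * D * C).val
        = C.valᴴ * (D.valᴴ * (u.valᴴ * A * u.val) * D.val) * C.val := fun C D => by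
      simp only [Units.val_mul, Matrix.conjTranspose_mul, Matrix.mul_assoc]
    rw [conj_eq]
    rcases eq_or_ne j k with rfl | hjk
    · exact hkC
    · exact hsC j hjk (hsD j hjk (hs j (Finset.mem_of_mem_insert_of_ne hj hjk)))

theorem IsPosDef.exists_mem_eq_conjTranspose_mul_self {A : Matrix (Fin n) (Fin n) F}
    (hA : IsPosDef A) (hdiag : ∀ d hd, diagUnit F d hd ∈ H)
    (htrans : ∀ k c hc, rowTransvection k c hc ∈ H) : ∃ u ∈ H, A = u.valᴴ * u.val := by
  obtain ⟨u, hu, h⟩ := hA.exists_mem_conj_eq_one hdiag htrans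
  refine ⟨u⁻¹, inv_mem hu, ?_⟩
  calc A = (u.val * (u⁻¹).val)ᴴ * A * (u.val * (u⁻¹).val) := by simp
    _ = (u⁻¹).valᴴ * (u.valᴴ * A * u.val) * (u⁻¹).val := by
      simp only [Matrix.conjTranspose_mul, Matrix.mul_assoc]
    _ = _ := by rw [h, Matrix.mul_one]

theorem IsPosDef.exists_eq_conjTranspose_mul_self {A : Matrix (Fin n) (Fin n) F}
    (hA : IsPosDef A) : ∃ u : (Matrix (Fin n) (Fin n) F)ˣ, A = u.valᴴ * u.val := by
  obtain ⟨u, -, hu⟩ := hA.exists_mem_eq_conjTranspose_mul_self (H := ⊤)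
    (fun _ _ => Subgroup.mem_top _) (fun _ _ _ => Subgroup.mem_top _)
  exact ⟨u, hu⟩

theorem IsPosDef.isUnit {A : Matrix (Fin n) (Fin n) F} (hA : IsPosDef A) : IsUnit A := by
  obtain ⟨u, rfl⟩ := hA.exists_eq_conjTranspose_mul_self
  exact (IsUnit.star u.isUnit).mul u.isUnit

theorem IsPosDef.detF_pos {A : Matrix (Fin n) (Fin n) F} (hA : IsPosDef A) : 0 < detF A :=
  detF_pos_of_isUnit hA.isUnit

theorem IsPosDef.inverse {A : Matrix (Fin n) (Fin n) F} (hA : IsPosDef A) :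
    IsPosDef (Ring.inverse A) := by
  obtain ⟨u, rfl⟩ := hA.exists_eq_conjTranspose_mul_self
  convert! isPosDef_conjTranspose_mul_self (star u⁻¹) using 1
  rw [show u.valᴴ * u.val = (star u * u).val from rfl, Ring.inverse_unit, mul_inv_rev]
  simp [Matrix.star_eq_conjTranspose]

end Elimination

section HermitianCoordinates

variable {F : Type*} [NormedDivisionRing F] [StarRing F] [InnerProductSpace ℝ F] {n : ℕ}

variable (F) in
/-- Real coordinates of Hermitian matrices, in the form expected by `hermOf`: the diagonal and the
entries above it. -/
abbrev HermCoord (n : ℕ) : Type _ := (Fin n → ℝ) × ({q : Fin n × Fin n // q.1 < q.2} → F)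

theorem hermOf_of_lt (p : HermCoord F n) {i j : Fin n} (h : i < j) :
    hermOf p i j = p.2 ⟨(i, j), h⟩ := by simp [hermOf, h]

theorem hermOf_of_gt (p : HermCoord F n) {i j : Fin n} (h : j < i) :
    hermOf p i j = star (p.2 ⟨(j, i), h⟩) := by simp [hermOf, h, h.not_gt]

theorem hermOf_diag (p : HermCoord F n) (i : Fin n) : hermOf p i i = p.1 i • (1 : F) := by
  simp [hermOf]

variable (F n) in
/-- The coordinates of a Hermitian matrix, extended to a linear map on all matrices so that it is a
left inverse of `hermOf`. -/
def hermCoord : Matrix (Fin n) (Fin n) F →ₗ[ℝ] HermCoord F n where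
  toFun A := (fun i => inner ℝ (1 : F) (A i i), fun q => A q.1.1 q.1.2)
  map_add' A B := by ext <;> simp [inner_add_right]
  map_smul' r A := by ext <;> simp [inner_smul_right]

theorem hermCoord_hermOf (p : HermCoord F n) : hermCoord F n (hermOf p) = p := by
  refine Prod.ext (funext fun i => ?_) (funext fun q => hermOf_of_lt p q.2)
  change inner ℝ (1 : F) (hermOf p i i) = _
  rw [hermOf_diag, inner_smul_right, inner_one_one, mul_one]

theorem hermOf_injective : Function.Injective (hermOf : HermCoord F n → _) :=
  Function.LeftInverse.injective hermCoord_hermOf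

variable [RealNormedDivisionAlgebra F]

theorem isHermitian_hermOf (p : HermCoord F n) : (hermOf p).IsHermitian := by
  refine Matrix.IsHermitian.ext fun i j => ?_
  rcases lt_trichotomy i j with h | rfl | h
  · rw [hermOf_of_lt p h, hermOf_of_gt p h, star_star]
  · rw [hermOf_diag, star_smul, star_one, star_trivial]
  · rw [hermOf_of_gt p h, hermOf_of_lt p h]

variable (F n) in
/-- `hermOf` as a real linear map. -/
def hermOfLin : HermCoord F n →ₗ[ℝ] Matrix (Fin n) (Fin n) F where
  toFun := hermOf
  map_add' p q := by
    ext i j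
    rw [Matrix.add_apply]
    rcases lt_trichotomy i j with h | rfl | h
    · simp [hermOf_of_lt _ h]
    · simp [hermOf_diag, add_smul]
    · simp [hermOf_of_gt _ h]
  map_smul' r p := by
    ext i j
    rw [Matrix.smul_apply]
    rcases lt_trichotomy i j with h | rfl | h
    · simp [hermOf_of_lt _ h]
    · simp [hermOf_diag, smul_smul]
    · simp [hermOf_of_gt _ h]

theorem hermOf_hermCoord {A : Matrix (Fin n) (Fin n) F} (hA : A.IsHermitian) :
    hermOf (hermCoord F n A) = A := by
  ext i j
  rcases lt_trichotomy i j with h | rfl | h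
  · exact hermOf_of_lt _ h
  · exact (hermOf_diag _ i).trans (diag_eq_smul_one_of_isHermitian hA i).symm
  · exact (hermOf_of_gt _ h).trans (hA.apply i j)

/-- The congruence `V ↦ B V Bᴴ` in Hermitian coordinates. -/
def congrLin (B : Matrix (Fin n) (Fin n) F) : HermCoord F n →ₗ[ℝ] HermCoord F n :=
  hermCoord F n ∘ₗ mulRightLinearMap (Fin n) ℝ Bᴴ ∘ₗ mulLeftLinearMap (Fin n) ℝ B ∘ₗ
    hermOfLin F n

theorem hermOf_congrLin (B : Matrix (Fin n) (Fin n) F) (p : HermCoord F n) :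
    hermOf (congrLin B p) = B * hermOf p * Bᴴ :=
  hermOf_hermCoord (Matrix.isHermitian_mul_mul_conjTranspose B (isHermitian_hermOf p))

theorem congrLin_one : congrLin (1 : Matrix (Fin n) (Fin n) F) = LinearMap.id :=
  LinearMap.ext fun p => hermOf_injective (by simp [hermOf_congrLin])

theorem congrLin_mul (A B : Matrix (Fin n) (Fin n) F) :
    congrLin (A * B) = congrLin A ∘ₗ congrLin B :=
  LinearMap.ext fun p => hermOf_injective <| by
    simp only [hermOf_congrLin, LinearMap.comp_apply, Matrix.conjTranspose_mul, Matrix.mul_assoc]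

variable (F n) in
/-- The absolute Jacobian of the congruence by an invertible matrix, as a character of `GLₙ(F)`. -/
def congrJac : (Matrix (Fin n) (Fin n) F)ˣ →* ℝ where
  toFun u := |LinearMap.det (congrLin u.val)|
  map_one' := by simp [congrLin_one]
  map_mul' u v := by rw [Units.val_mul, congrLin_mul, LinearMap.det_comp, abs_mul]

variable (F n) in
/-- The character `u ↦ |u| ^ s` of `GLₙ(F)`. -/
def detFPow (s : ℝ) : (Matrix (Fin n) (Fin n) F)ˣ →* ℝ where
  toFun u := detF u.val ^ s
  map_one' := by simp [detF_one]
  map_mul' u v := by rw [Units.val_mul, detF_mul, Real.mul_rpow (detF_nonneg _) (detF_nonneg _)]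

theorem congrLin_diagUnit (d : Fin n → ℝ) (hd : ∀ i, d i ≠ 0) :
    congrLin (diagUnit F d hd).val = LinearMap.prodMap
      (LinearMap.pi fun i => (d i ^ 2 • (LinearMap.id : ℝ →ₗ[ℝ] ℝ)) ∘ₗ LinearMap.proj i)
      (LinearMap.pi fun q => ((d q.1.1 * d q.1.2) • (LinearMap.id : F →ₗ[ℝ] F)) ∘ₗ
        LinearMap.proj q) := by
  refine LinearMap.ext fun p => hermOf_injective ?_
  rw [hermOf_congrLin, conjTranspose_diagUnit]
  ext i j
  rw [diagUnit_mul_mul_diagUnit_apply]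
  rcases lt_trichotomy i j with h | rfl | h
  · simp [hermOf_of_lt _ h]
  · simp [hermOf_diag, smul_smul, sq]
  · simp [hermOf_of_gt _ h, mul_comm]

theorem prod_lt_mul_prod_eq_prod_pow {M : Type*} [CommMonoid M] (d : Fin n → M) :
    (∏ q : {q : Fin n × Fin n // q.1 < q.2}, d q.1.1 * d q.1.2) * ∏ i, d i
      = (∏ i, d i) ^ n := by
  have pow_eq : (∏ i, d i) ^ n = ∏ p : Fin n × Fin n, d p.1 := by
    rw [Fintype.prod_prod_type]; simp [Finset.prod_pow]
  have prod_eq : ∏ i, d i = ∏ p : Fin n × Fin n, if p.1 = p.2 then d p.1 else 1 := by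
    rw [Fintype.prod_prod_type]; simp
  have prod_fst_eq : ∏ q : {q : Fin n × Fin n // q.1 < q.2}, d q.1.1
      = ∏ p : Fin n × Fin n, if p.1 < p.2 then d p.1 else 1 := by
    rw [← Finset.prod_filter]
    exact (Finset.prod_subtype _ (by simp) (fun p : Fin n × Fin n => d p.1)).symm
  have prod_snd_eq : ∏ q : {q : Fin n × Fin n // q.1 < q.2}, d q.1.2
      = ∏ p : Fin n × Fin n, if p.2 < p.1 then d p.1 else 1 := by
    rw [Fintype.prod_prod_type, Finset.prod_comm, ← Fintype.prod_prod_type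
      (fun p : Fin n × Fin n => if p.1 < p.2 then d p.2 else 1), ← Finset.prod_filter]
    exact (Finset.prod_subtype _ (by simp) (fun p : Fin n × Fin n => d p.2)).symm
  rw [pow_eq, Finset.prod_mul_distrib, prod_fst_eq, prod_snd_eq, prod_eq, ← Finset.prod_mul_distrib,
    ← Finset.prod_mul_distrib]
  refine Finset.prod_congr rfl fun p _ => ?_
  rcases lt_trichotomy p.1 p.2 with h | h | h
  · simp [h, h.ne, h.not_gt]
  · simp [h]
  · simp [h, h.ne', h.not_gt]

variable [FiniteDimensional ℝ F]

theorem detF_diagUnit (d : Fin n → ℝ) (hd : ∀ i, d i ≠ 0) :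
    detF (diagUnit F d hd).val = ∏ i, |d i| := by
  have realLin_eq : realLin (diagUnit F d hd).val
      = LinearMap.pi fun i => (d i • (LinearMap.id : F →ₗ[ℝ] F)) ∘ₗ LinearMap.proj i := by
    refine LinearMap.ext fun x => funext fun i => ?_
    change ((Matrix.diagonal fun i => d i • (1 : F)) *ᵥ x) i = d i • x i
    rw [Matrix.mulVec_diagonal, smul_one_mul]
  have prod_nonneg : 0 ≤ ∏ i, |d i| := Finset.prod_nonneg fun i _ => abs_nonneg _
  rw [detF, realLin_eq, LinearMap.det_pi]
  simp only [LinearMap.det_smul, LinearMap.det_id, mul_one, Finset.prod_pow]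
  rw [abs_pow, Finset.abs_prod, ← Real.rpow_natCast, ← Real.rpow_mul prod_nonneg]
  exact (congrArg _ (mul_one_div_cancel (rdim_pos F).ne')).trans (Real.rpow_one _)

theorem congrJac_diagUnit (d : Fin n → ℝ) (hd : ∀ i, d i ≠ 0) :
    congrJac F n (diagUnit F d hd) = (∏ i, |d i|) ^ (rdim F * ((n : ℝ) - 1) + 2) := by
  have prod_pos : 0 < ∏ i, |d i| := Finset.prod_pos fun i _ => abs_pos.2 (hd i)
  have prod_pairs : ∏ q : {q : Fin n × Fin n // q.1 < q.2}, |d q.1.1 * d q.1.2|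
      = (∏ i, |d i|) ^ ((n : ℝ) - 1) := by
    rw [Real.rpow_sub prod_pos, Real.rpow_one, Real.rpow_natCast, eq_div_iff prod_pos.ne',
      ← prod_lt_mul_prod_eq_prod_pow]
    simp only [abs_mul]
  change |LinearMap.det (congrLin (diagUnit F d hd).val)| = _
  rw [congrLin_diagUnit, LinearMap.det_prodMap, LinearMap.det_pi, LinearMap.det_pi]
  simp only [LinearMap.det_smul, LinearMap.det_id, mul_one, Finset.prod_pow, Module.finrank_self,
    pow_one]
  rw [abs_mul, abs_pow, abs_pow, Finset.abs_prod, Finset.abs_prod, prod_pairs,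
    ← Real.rpow_natCast _ (Module.finrank ℝ F), ← Real.rpow_mul prod_pos.le,
    Real.rpow_add prod_pos, mul_comm, Real.rpow_two, mul_comm (rdim F)]
  rfl

theorem IsPosDef.exists_congrJac_eq_detF_rpow {A : Matrix (Fin n) (Fin n) F} (hA : IsPosDef A) :
    ∃ u : (Matrix (Fin n) (Fin n) F)ˣ, A = u.valᴴ * u.val ∧
      |LinearMap.det (congrLin u.val)| = detF u.val ^ (rdim F * ((n : ℝ) - 1) + 2) := by
  obtain ⟨u, hu, hA⟩ := hA.exists_mem_eq_conjTranspose_mul_self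
    (H := (congrJac F n).eqLocus (detFPow F n (rdim F * ((n : ℝ) - 1) + 2)))
    (fun d hd => (congrJac_diagUnit d hd).trans
      (congrArg (· ^ (rdim F * ((n : ℝ) - 1) + 2)) (detF_diagUnit d hd).symm))
    (fun k c hc => (map_rowTransvection _ k c hc).trans (map_rowTransvection _ k c hc).symm)
  exact ⟨u, hA, hu⟩

end HermitianCoordinates

section MultiplicationJacobians

variable {F : Type*} [NormedDivisionRing F] [StarRing F] [InnerProductSpace ℝ F]
  [RealNormedDivisionAlgebra F] [FiniteDimensional ℝ F] {m n : ℕ}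

theorem abs_det_mulLeftLinearMap (n : ℕ) (B : Matrix (Fin m) (Fin m) F) :
    |LinearMap.det (mulLeftLinearMap (Fin n) ℝ B)| = detF B ^ (rdim F * n) := by
  let e : (Fin n → Fin m → F) ≃ₗ[ℝ] Matrix (Fin m) (Fin n) F :=
    Matrix.transposeLinearEquiv (Fin n) (Fin m) ℝ F
  have columnwise : mulLeftLinearMap (Fin n) ℝ B
      = e.toLinearMap ∘ₗ (LinearMap.pi fun j => realLin B ∘ₗ LinearMap.proj j) ∘ₗ
        e.symm.toLinearMap := rfl
  rw [columnwise, LinearMap.det_conj, LinearMap.det_pi, Finset.prod_const, Finset.card_univ,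
    Fintype.card_fin, abs_pow, ← detF_rpow_rdim, Real.rpow_mul (detF_nonneg _), Real.rpow_natCast]

theorem abs_det_mulRightLinearMap (m : ℕ) (L : Matrix (Fin n) (Fin n) F) :
    |LinearMap.det (mulRightLinearMap (Fin m) ℝ L)| = detF L ^ (rdim F * m) := by
  let e : (Fin n → F) ≃ₗ[ℝ] (Fin n → F) := (starL' ℝ).toLinearEquiv
  have rowwise : mulRightLinearMap (Fin m) ℝ L = LinearMap.pi (φ := fun _ => Fin n → F)
      fun i => (e ∘ₗ realLin Lᴴ ∘ₗ e.symm) ∘ₗ LinearMap.proj i := by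
    refine LinearMap.ext fun X => funext fun i => ?_
    change X i ᵥ* L = star (Lᴴ *ᵥ star (X i))
    rw [Matrix.star_mulVec, star_star, Matrix.conjTranspose_conjTranspose]
  rw [rowwise]
  refine (congrArg abs (LinearMap.det_pi _)).trans ?_
  rw [Finset.prod_const, Finset.card_univ, Fintype.card_fin, LinearMap.det_conj, abs_pow,
    ← detF_rpow_rdim, detF_conjTranspose, Real.rpow_mul (detF_nonneg _), Real.rpow_natCast]

end MultiplicationJacobians

section Continuity

variable {F : Type*} [NormedDivisionRing F] [StarRing F] [InnerProductSpace ℝ F]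
  [RealNormedDivisionAlgebra F] {n : ℕ}

theorem continuous_retr {F : Type*} [NormedDivisionRing F] [InnerProductSpace ℝ F] :
    Continuous (retr : Matrix (Fin n) (Fin n) F → ℝ) :=
  continuous_const.inner (Continuous.matrix_trace continuous_id)

theorem isPosDef_iff_sphere (A : Matrix (Fin n) (Fin n) F) :
    IsPosDef A ↔ A.IsHermitian ∧
      ∀ x ∈ Metric.sphere (0 : Fin n → F) 1, 0 < inner ℝ (1 : F) (star x ⬝ᵥ (A *ᵥ x)) := by
  refine and_congr_right fun _ => ⟨fun h x hx => h x (Metric.ne_of_mem_sphere hx one_ne_zero),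
    fun h x hx => ?_⟩
  have norm_pos : 0 < ‖x‖ := norm_pos_iff.2 hx
  have pos_unit := h (‖x‖⁻¹ • x) (by simp [norm_smul, norm_pos.ne'])
  rw [star_smul, star_trivial, Matrix.mulVec_smul, smul_dotProduct, dotProduct_smul,
    inner_smul_right, inner_smul_right] at pos_unit
  exact pos_of_mul_pos_right (pos_of_mul_pos_right pos_unit (by positivity)) (by positivity)

variable [FiniteDimensional ℝ F]

theorem isOpen_forall_sphere_pos : IsOpen {A : Matrix (Fin n) (Fin n) F |
    ∀ x ∈ Metric.sphere (0 : Fin n → F) 1, 0 < inner ℝ (1 : F) (star x ⬝ᵥ (A *ᵥ x))} := by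
  have : ProperSpace (Fin n → F) := FiniteDimensional.proper_real _
  rw [isOpen_iff_eventually]
  intro A hA
  refine (isCompact_sphere (0 : Fin n → F) 1).eventually_forall_of_forall_eventually fun x hx => ?_
  have hc : Continuous fun z : Matrix (Fin n) (Fin n) F × (Fin n → F) =>
      inner ℝ (1 : F) (star z.2 ⬝ᵥ (z.1 *ᵥ z.2)) :=
    continuous_const.inner (continuous_snd.star.dotProduct
      (continuous_fst.matrix_mulVec continuous_snd))
  exact hc.continuousAt.eventually_const_lt (hA x hx)

theorem continuous_detF : Continuous (detF : Matrix (Fin n) (Fin n) F → ℝ) := by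
  let b := Module.finBasis ℝ (Fin n → F)
  have continuous_det : Continuous fun A : Matrix (Fin n) (Fin n) F =>
      LinearMap.det (realLin A) := by
    simp_rw [← LinearMap.det_toMatrix b]
    refine Continuous.matrix_det (continuous_matrix fun i j => ?_)
    simp_rw [LinearMap.toMatrix_apply]
    exact (LinearMap.continuous_of_finiteDimensional (b.coord i)).comp
      (Continuous.matrix_mulVec continuous_id continuous_const)
  exact continuous_det.abs.rpow_const fun _ => Or.inr (one_div_nonneg.2 (rdim_pos F).le)

theorem continuous_hermOf : Continuous (hermOf : HermCoord F n → Matrix (Fin n) (Fin n) F) :=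
  LinearMap.continuous_of_finiteDimensional (hermOfLin F n)

theorem isOpen_isPosDef_hermOf : IsOpen {p : HermCoord F n | IsPosDef (hermOf p)} := by
  simp_rw [isPosDef_iff_sphere, isHermitian_hermOf, true_and]
  exact isOpen_forall_sphere_pos.preimage continuous_hermOf

end Continuity

section Integration

theorem ofReal_abs_det_mul_lintegral_comp {E : Type*} [NormedAddCommGroup E] [NormedSpace ℝ E]
    [FiniteDimensional ℝ E] [MeasurableSpace E] [BorelSpace E] (μ : Measure E)
    [μ.IsAddHaarMeasure] {g : E →ₗ[ℝ] E} (hg : LinearMap.det g ≠ 0) (f : E → ENNReal) :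
    ENNReal.ofReal |LinearMap.det g| * ∫⁻ x, f (g x) ∂μ = ∫⁻ x, f x ∂μ := by
  have hbij : Function.Bijective g := (g.equivOfDetNeZero hg).bijective
  have h := lintegral_image_eq_lintegral_abs_det_fderiv_mul μ MeasurableSet.univ
    (fun x _ => (LinearMap.toContinuousLinearMap g).hasFDerivWithinAt) hbij.1.injOn f
  rw [LinearMap.coe_toContinuousLinearMap', Set.image_univ_of_surjective hbij.2,
    setLIntegral_univ, setLIntegral_univ] at h
  rw [← lintegral_const_mul' _ _ ENNReal.ofReal_ne_top, h]
  rfl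

variable {F : Type*} [NormedDivisionRing F] [InnerProductSpace ℝ F]
  [FiniteDimensional ℝ F] [MeasurableSpace F] [BorelSpace F] {m n : ℕ}

instance : BorelSpace (Matrix (Fin m) (Fin n) F) :=
  inferInstanceAs (BorelSpace (Fin m → Fin n → F))

instance : SecondCountableTopology (Matrix (Fin m) (Fin n) F) :=
  inferInstanceAs (SecondCountableTopology (Fin m → Fin n → F))

instance {ι : Type*} [Fintype ι] :
    (Measure.pi fun _ : ι => (volume : Measure F)).IsAddHaarMeasure :=
  Measure.pi.isAddHaarMeasure _

instance : (volume : Measure (Fin m → Fin n → F)).IsAddHaarMeasure :=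
  Measure.pi.isAddHaarMeasure fun _ : Fin m => Measure.pi fun _ : Fin n => (volume : Measure F)

instance : (volume : Measure (HermCoord F n)).IsAddHaarMeasure :=
  Measure.prod.instIsAddHaarMeasure (Measure.pi fun _ : Fin n => (volume : Measure ℝ))
    (Measure.pi fun _ : {q : Fin n × Fin n // q.1 < q.2} => (volume : Measure F))

instance : SFinite (matVolume F m n) :=
  inferInstanceAs (SFinite (volume : Measure (Fin m → Fin n → F)))

theorem lintegral_matVolume_sub (M : Matrix (Fin m) (Fin n) F)
    (f : Matrix (Fin m) (Fin n) F → ENNReal) :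
    ∫⁻ X, f (X - M) ∂matVolume F m n = ∫⁻ X, f X ∂matVolume F m n :=
  lintegral_sub_right_eq_self (μ := (volume : Measure (Fin m → Fin n → F))) f M

theorem measurable_retr : Measurable (retr : Matrix (Fin n) (Fin n) F → ℝ) :=
  continuous_retr.measurable

variable [StarRing F]

instance : SFinite (hermVolume F n) :=
  inferInstanceAs (SFinite ((volume : Measure (HermCoord F n)).map hermOf))

variable [RealNormedDivisionAlgebra F]

theorem measurable_detF : Measurable (detF : Matrix (Fin n) (Fin n) F → ℝ) :=
  continuous_detF.measurable

theorem measurableSet_isPosDef : MeasurableSet {A : Matrix (Fin n) (Fin n) F | IsPosDef A} := by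
  simp_rw [isPosDef_iff_sphere]
  have isClosed_isHermitian : IsClosed {A : Matrix (Fin n) (Fin n) F | A.IsHermitian} :=
    isClosed_eq continuous_id.matrix_conjTranspose continuous_id
  exact isClosed_isHermitian.measurableSet.inter isOpen_forall_sphere_pos.measurableSet

theorem measurableEmbedding_hermOf :
    MeasurableEmbedding (hermOf : HermCoord F n → Matrix (Fin n) (Fin n) F) :=
  (LinearMap.isClosedEmbedding_of_injective (f := hermOfLin F n)
    (LinearMap.ker_eq_bot.2 hermOf_injective)).measurableEmbedding

theorem lintegral_hermVolume (f : Matrix (Fin n) (Fin n) F → ENNReal) :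
    ∫⁻ V, f V ∂hermVolume F n = ∫⁻ p : HermCoord F n, f (hermOf p) :=
  measurableEmbedding_hermOf.lintegral_map f

theorem lintegral_hermVolume_conj (u : (Matrix (Fin n) (Fin n) F)ˣ)
    (f : Matrix (Fin n) (Fin n) F → ENNReal) :
    ENNReal.ofReal |LinearMap.det (congrLin u.val)| *
        ∫⁻ V, f (u.val * V * u.valᴴ) ∂hermVolume F n = ∫⁻ V, f V ∂hermVolume F n := by
  have det_ne_zero : LinearMap.det (congrLin u.val) ≠ 0 :=
    abs_ne_zero.1 ((Group.isUnit u).map (congrJac F n)).ne_zero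
  simp_rw [lintegral_hermVolume, ← hermOf_congrLin]
  exact ofReal_abs_det_mul_lintegral_comp volume det_ne_zero fun p => f (hermOf p)

theorem lintegral_matVolume_mul_left {B : Matrix (Fin m) (Fin m) F} (hB : IsUnit B)
    (f : Matrix (Fin m) (Fin n) F → ENNReal) :
    ENNReal.ofReal (detF B ^ (rdim F * n)) * ∫⁻ X, f (B * X) ∂matVolume F m n
      = ∫⁻ X, f X ∂matVolume F m n := by
  have det_ne_zero : LinearMap.det (mulLeftLinearMap (Fin n) ℝ B) ≠ 0 := by
    rw [← abs_ne_zero, abs_det_mulLeftLinearMap]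
    exact (Real.rpow_pos_of_pos (detF_pos_of_isUnit hB) _).ne'
  rw [← abs_det_mulLeftLinearMap]
  exact ofReal_abs_det_mul_lintegral_comp (E := Fin m → Fin n → F) volume det_ne_zero f

theorem lintegral_matVolume_mul_right {L : Matrix (Fin n) (Fin n) F} (hL : IsUnit L)
    (f : Matrix (Fin m) (Fin n) F → ENNReal) :
    ENNReal.ofReal (detF L ^ (rdim F * m)) * ∫⁻ X, f (X * L) ∂matVolume F m n
      = ∫⁻ X, f X ∂matVolume F m n := by
  have det_ne_zero : LinearMap.det (mulRightLinearMap (Fin m) ℝ L) ≠ 0 := by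
    rw [← abs_ne_zero, abs_det_mulRightLinearMap]
    exact (Real.rpow_pos_of_pos (detF_pos_of_isUnit hL) _).ne'
  rw [← abs_det_mulRightLinearMap]
  exact ofReal_abs_det_mul_lintegral_comp (E := Fin m → Fin n → F) volume det_ne_zero f

theorem integral_exp_neg_retr_mul_conjTranspose_self :
    ∫ X : Matrix (Fin m) (Fin n) F, Real.exp (-retr (X * Xᴴ)) ∂matVolume F m n
      = Real.pi ^ (m * n * rdim F / 2) := by
  have exp_eq_prod (X : Fin m → Fin n → F) : Real.exp (-retr (Matrix.of X * (Matrix.of X)ᴴ))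
      = ∏ i, ∏ j, Real.exp (-1 * ‖X i j‖ ^ 2) := by
    simp_rw [retr_mul_conjTranspose_self, ← Finset.sum_neg_distrib, Real.exp_sum, neg_one_mul]
    rfl
  calc _ = ∫ X : Fin m → Fin n → F, ∏ i, ∏ j, Real.exp (-1 * ‖X i j‖ ^ 2) :=
        integral_congr_ae (.of_forall exp_eq_prod)
    _ = ((Real.pi ^ (rdim F / 2)) ^ n) ^ m := by
      rw [integral_fintype_prod_volume_eq_pow (fun x : Fin n → F => ∏ j, Real.exp (-1 * ‖x j‖ ^ 2)),
        integral_fintype_prod_volume_eq_pow (fun z : F => Real.exp (-1 * ‖z‖ ^ 2)),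
        GaussianFourier.integral_rexp_neg_mul_sq_norm one_pos, div_one, Fintype.card_fin,
        Fintype.card_fin]
      rfl
    _ = _ := by
      rw [← Real.rpow_mul_natCast Real.pi_pos.le, ← Real.rpow_mul_natCast Real.pi_pos.le]
      congr 1
      ring

theorem lintegral_exp_neg_retr_mul_conjTranspose_self :
    ∫⁻ X : Matrix (Fin m) (Fin n) F, ENNReal.ofReal (Real.exp (-retr (X * Xᴴ))) ∂matVolume F m n
      = ENNReal.ofReal (Real.pi ^ (m * n * rdim F / 2)) := by
  have integral_eq := integral_exp_neg_retr_mul_conjTranspose_self (F := F) (m := m) (n := n)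
  have integrable := not_imp_comm.1 integral_undef (integral_eq.trans_ne (by positivity))
  rw [← integral_eq, ofReal_integral_eq_lintegral_ofReal integrable
    (.of_forall fun _ => (Real.exp_pos _).le)]

end Integration

section GammaIntegral

variable {F : Type*} [NormedDivisionRing F] [StarRing F] [InnerProductSpace ℝ F]

theorem isPosDef_conj_iff {n : ℕ} (u : (Matrix (Fin n) (Fin n) F)ˣ)
    {V : Matrix (Fin n) (Fin n) F} : IsPosDef (u.val * V * u.valᴴ) ↔ IsPosDef V := by
  have conj_star (w : (Matrix (Fin n) (Fin n) F)ˣ) {V : Matrix (Fin n) (Fin n) F}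
      (hV : IsPosDef V) : IsPosDef (w.val * V * w.valᴴ) := by
    have h := hV.conj (star w)
    rwa [Units.coe_star, Matrix.star_eq_conjTranspose, Matrix.conjTranspose_conjTranspose] at h
  refine ⟨fun h => ?_, conj_star u⟩
  have h' := conj_star u⁻¹ h
  have conj_inv_conj : (u⁻¹).val * (u.val * V * u.valᴴ) * (u⁻¹).valᴴ = V := by
    rw [← Matrix.mul_assoc, ← Matrix.mul_assoc, Units.inv_mul, Matrix.one_mul, Matrix.mul_assoc,
      ← Matrix.conjTranspose_mul, Units.inv_mul, Matrix.conjTranspose_one, Matrix.mul_one]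
  rwa [conj_inv_conj] at h'

variable [RealNormedDivisionAlgebra F] [FiniteDimensional ℝ F]

theorem detF_conj {n : ℕ} (u : Matrix (Fin n) (Fin n) F) (V : Matrix (Fin n) (Fin n) F) :
    detF (u * V * uᴴ) = detF u ^ 2 * detF V := by
  rw [detF_mul, detF_mul, detF_conjTranspose]
  ring

theorem detF_conjTranspose_mul_self_rpow {n : ℕ} (u : Matrix (Fin n) (Fin n) F) (s : ℝ) :
    detF (uᴴ * u) ^ s = detF u ^ (2 * s) := by
  rw [detF_mul, detF_conjTranspose, ← sq, ← Real.rpow_natCast, ← Real.rpow_mul (detF_nonneg u)]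
  norm_num

variable [MeasurableSpace F] [BorelSpace F] {m n : ℕ}

variable (F n) in
/-- The measure `|V| ^ (-(n - 1) β / 2 - 1) (dV)` on the cone of positive definite matrices. It is
invariant under `V ↦ u V uᴴ`, and `Γ_n^β[a]` is the integral of `etr(-V) |V| ^ a` against it. -/
def posDefMeasure : Measure (Matrix (Fin n) (Fin n) F) :=
  ((hermVolume F n).restrict {V | IsPosDef V}).withDensity fun V =>
    ENNReal.ofReal (detF V ^ (-(((n : ℝ) - 1) * rdim F / 2 + 1)))

instance : SFinite (posDefMeasure F n) :=
  inferInstanceAs (SFinite (Measure.withDensity _ _))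

theorem ae_isPosDef_posDefMeasure : ∀ᵐ V ∂posDefMeasure F n, IsPosDef V :=
  (withDensity_absolutelyContinuous _ _).ae_le (ae_restrict_mem measurableSet_isPosDef)

theorem lintegral_posDefMeasure (f : Matrix (Fin n) (Fin n) F → ENNReal) :
    ∫⁻ V, f V ∂posDefMeasure F n = ∫⁻ V in {V | IsPosDef V},
      ENNReal.ofReal (detF V ^ (-(((n : ℝ) - 1) * rdim F / 2 + 1))) * f V ∂hermVolume F n :=
  lintegral_withDensity_eq_lintegral_mul_non_measurable _
    (measurable_detF.pow_const _).ennreal_ofReal (.of_forall fun _ => ENNReal.ofReal_lt_top) f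

theorem IsPosDef.exists_lintegral_posDefMeasure_conj {A : Matrix (Fin n) (Fin n) F}
    (hA : IsPosDef A) : ∃ u : (Matrix (Fin n) (Fin n) F)ˣ, A = u.valᴴ * u.val ∧
      ∀ f : Matrix (Fin n) (Fin n) F → ENNReal,
        ∫⁻ V, f (u.val * V * u.valᴴ) ∂posDefMeasure F n = ∫⁻ V, f V ∂posDefMeasure F n := by
  obtain ⟨u, hu, hJ⟩ := hA.exists_congrJac_eq_detF_rpow
  refine ⟨u, hu, fun f => ?_⟩
  have hu_pos := detF_pos_of_isUnit u.isUnit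
  have jacobian_cancels : detF u.val ^ (rdim F * ((n : ℝ) - 1) + 2) *
      (detF u.val ^ 2) ^ (-(((n : ℝ) - 1) * rdim F / 2 + 1)) = 1 := by
    rw [← Real.rpow_natCast, ← Real.rpow_mul hu_pos.le, ← Real.rpow_add hu_pos]
    convert Real.rpow_zero (detF u.val) using 2
    push_cast
    ring
  rw [lintegral_posDefMeasure, lintegral_posDefMeasure,
    ← lintegral_indicator measurableSet_isPosDef, ← lintegral_indicator measurableSet_isPosDef]
  refine Eq.trans ?_ (lintegral_hermVolume_conj u _)
  rw [hJ, ← lintegral_const_mul' _ _ ENNReal.ofReal_ne_top]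
  refine lintegral_congr fun V => ?_
  by_cases hV : IsPosDef V
  · rw [Set.indicator_of_mem (by exact hV),
      Set.indicator_of_mem (by exact (isPosDef_conj_iff u).2 hV), ← mul_assoc,
      ← ENNReal.ofReal_mul (by positivity), detF_conj,
      Real.mul_rpow (by positivity) (detF_nonneg V), ← mul_assoc, jacobian_cancels, one_mul]
  · rw [Set.indicator_of_notMem (by exact hV),
      Set.indicator_of_notMem (by exact fun h => hV ((isPosDef_conj_iff u).1 h)), mul_zero]

variable (F n) in
/-- The Gamma integral `Γ_n^β[a]` as an extended nonnegative real, which makes sense before its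
convergence is known. -/
def lmvGamma (a : ℝ) : ENNReal :=
  ∫⁻ V, ENNReal.ofReal (Real.exp (-retr V) * detF V ^ a) ∂posDefMeasure F n

theorem measurable_ofReal_detF_add_conj (M : Matrix (Fin m) (Fin m) F)
    (N : Matrix (Fin n) (Fin n) F) (s : ℝ) :
    Measurable fun T : Matrix (Fin m) (Fin n) F => ENNReal.ofReal (detF (M + T * N * Tᴴ) ^ s) :=
  ((measurable_detF.comp (Continuous.measurable (by fun_prop))).pow_const s).ennreal_ofReal

theorem lintegral_exp_neg_retr_mul {A : Matrix (Fin n) (Fin n) F} (hA : IsPosDef A) (a : ℝ) :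
    ∫⁻ V, ENNReal.ofReal (Real.exp (-retr (A * V)) * detF V ^ a) ∂posDefMeasure F n
      = ENNReal.ofReal (detF A ^ (-a)) * lmvGamma F n a := by
  obtain ⟨u, hu, conj_invariant⟩ := hA.exists_lintegral_posDefMeasure_conj
  rw [lmvGamma, ← conj_invariant fun V => ENNReal.ofReal (Real.exp (-retr V) * detF V ^ a),
    ← lintegral_const_mul' _ _ ENNReal.ofReal_ne_top]
  refine lintegral_congr fun V => ?_
  have retr_conj : retr (u.val * V * u.valᴴ) = retr (A * V) := by
    rw [retr_mul_comm, hu, ← Matrix.mul_assoc]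
  have detF_eq : detF (u.val * V * u.valᴴ) = detF A * detF V := by
    rw [hu, detF_conj, detF_mul, detF_conjTranspose, ← sq]
  rw [retr_conj, detF_eq, Real.mul_rpow (detF_nonneg _) (detF_nonneg _),
    ← ENNReal.ofReal_mul (Real.rpow_nonneg (detF_nonneg _) _), mul_left_comm, ← mul_assoc (_ ^ _),
    ← Real.rpow_add hA.detF_pos, neg_add_cancel, Real.rpow_zero, one_mul]

theorem lintegral_exp_neg_retr_conj {V : Matrix (Fin m) (Fin m) F} (hV : IsPosDef V)
    {N : Matrix (Fin n) (Fin n) F} (hN : IsPosDef N) :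
    ∫⁻ T, ENNReal.ofReal (Real.exp (-retr (T * N * Tᴴ * V))) ∂matVolume F m n
      = ENNReal.ofReal (Real.pi ^ (m * n * rdim F / 2) * detF N ^ (-(rdim F * m / 2)) *
        detF V ^ (-(rdim F * n / 2))) := by
  obtain ⟨u, rfl⟩ := hV.exists_eq_conjTranspose_mul_self
  obtain ⟨w, rfl⟩ := hN.exists_eq_conjTranspose_mul_self
  have hu := detF_pos_of_isUnit u.isUnit
  have hw := detF_pos_of_isUnit w.isUnit
  have rpow_cancel {t : ℝ} (ht : 0 < t) (s : ℝ) : t ^ s * t ^ (2 * -(s / 2)) = 1 := by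
    rw [← Real.rpow_add ht, mul_neg, mul_div_cancel₀ _ two_ne_zero, add_neg_cancel,
      Real.rpow_zero]
  have retr_eq (T : Matrix (Fin m) (Fin n) F) : retr (T * (w.valᴴ * w.val) * Tᴴ * (u.valᴴ * u.val))
      = retr (u.val * (T * w.valᴴ) * (u.val * (T * w.valᴴ))ᴴ) := by
    rw [← Matrix.mul_assoc _ _ u.val, retr_mul_comm]
    simp only [Matrix.conjTranspose_mul, Matrix.conjTranspose_conjTranspose, Matrix.mul_assoc]
  have gaussian := lintegral_exp_neg_retr_mul_conjTranspose_self (F := F) (m := m) (n := n)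
  rw [← lintegral_matVolume_mul_left u.isUnit, ← lintegral_matVolume_mul_right (L := w.valᴴ)
    (IsUnit.star w.isUnit), ← mul_assoc, ← ENNReal.ofReal_mul (by positivity),
    detF_conjTranspose] at gaussian
  simp_rw [retr_eq]
  rw [detF_conjTranspose_mul_self_rpow, detF_conjTranspose_mul_self_rpow, mul_assoc,
    ENNReal.ofReal_mul (by positivity), ← gaussian, mul_right_comm,
    ← ENNReal.ofReal_mul (by positivity), mul_comm (detF w.val ^ _), mul_mul_mul_comm,
    rpow_cancel hu, rpow_cancel hw, mul_one, ENNReal.ofReal_one, one_mul]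

theorem lmvGamma_mul_lintegral_detF_add_conj {M : Matrix (Fin m) (Fin m) F} (hM : IsPosDef M)
    {N : Matrix (Fin n) (Fin n) F} (hN : IsPosDef N) (a : ℝ) :
    lmvGamma F m a * ∫⁻ T, ENNReal.ofReal (detF (M + T * N * Tᴴ) ^ (-a)) ∂matVolume F m n
      = ENNReal.ofReal (Real.pi ^ (m * n * rdim F / 2) * detF N ^ (-(rdim F * m / 2)) *
          detF M ^ (-(a - rdim F * n / 2))) * lmvGamma F m (a - rdim F * n / 2) := by
  have hc : 0 ≤ Real.pi ^ (m * n * rdim F / 2) * detF N ^ (-(rdim F * m / 2)) := by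
    have := hN.detF_pos
    positivity
  let g (V : Matrix (Fin m) (Fin m) F) := Real.exp (-retr (M * V)) * detF V ^ a
  have hg (V : Matrix (Fin m) (Fin m) F) : 0 ≤ g V :=
    mul_nonneg (Real.exp_pos _).le (Real.rpow_nonneg (detF_nonneg V) a)
  have integrate_V (T : Matrix (Fin m) (Fin n) F) :
      lmvGamma F m a * ENNReal.ofReal (detF (M + T * N * Tᴴ) ^ (-a))
        = ∫⁻ V, ENNReal.ofReal (g V * Real.exp (-retr (T * N * Tᴴ * V))) ∂posDefMeasure F m := by
    have hMT : IsPosDef (M + T * N * Tᴴ) := by simpa using hM.add_conj hN Tᴴ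
    rw [mul_comm, ← lintegral_exp_neg_retr_mul hMT]
    refine lintegral_congr fun V => ?_
    rw [Matrix.add_mul, retr_add, neg_add, Real.exp_add, mul_right_comm]
  have integrate_T {V : Matrix (Fin m) (Fin m) F} (hV : IsPosDef V) :
      ∫⁻ T, ENNReal.ofReal (g V * Real.exp (-retr (T * N * Tᴴ * V))) ∂matVolume F m n
        = ENNReal.ofReal (Real.pi ^ (m * n * rdim F / 2) * detF N ^ (-(rdim F * m / 2))) *
          ENNReal.ofReal (Real.exp (-retr (M * V)) * detF V ^ (a - rdim F * n / 2)) := by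
    simp_rw [ENNReal.ofReal_mul (hg V)]
    rw [lintegral_const_mul' _ _ ENNReal.ofReal_ne_top, lintegral_exp_neg_retr_conj hV hN,
      ← ENNReal.ofReal_mul (hg V), ← ENNReal.ofReal_mul hc, sub_eq_add_neg,
      Real.rpow_add hV.detF_pos]
    congr 1
    ring
  have hmeas : Measurable fun z : Matrix (Fin m) (Fin n) F × Matrix (Fin m) (Fin m) F =>
      ENNReal.ofReal (g z.2 * Real.exp (-retr (z.1 * N * z.1ᴴ * z.2))) := by
    have hgm : Measurable g := (measurable_retr.comp
      (Continuous.measurable (by fun_prop))).neg.exp.mul (measurable_detF.pow_const a)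
    exact ((hgm.comp measurable_snd).mul (measurable_retr.comp
      (Continuous.measurable (by fun_prop))).neg.exp).ennreal_ofReal
  rw [← lintegral_const_mul _ (measurable_ofReal_detF_add_conj M N (-a))]
  simp_rw [integrate_V]
  rw [lintegral_lintegral_swap hmeas.aemeasurable,
    lintegral_congr_ae (ae_isPosDef_posDefMeasure.mono fun V hV => integrate_T hV),
    lintegral_const_mul' _ _ ENNReal.ofReal_ne_top, lintegral_exp_neg_retr_mul hM, ← mul_assoc,
    ← ENNReal.ofReal_mul hc]

end GammaIntegral

section GammaConvergence

variable {F : Type*} [NormedDivisionRing F] [StarRing F] [InnerProductSpace ℝ F]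
  [RealNormedDivisionAlgebra F] {m n : ℕ}

theorem inner_one_conjTranspose_mul_self_apply_self (u : Matrix (Fin m) (Fin n) F) (i : Fin n) :
    inner ℝ (1 : F) ((uᴴ * u) i i) = ∑ k, ‖u k i‖ ^ 2 := by
  simp only [Matrix.mul_apply, inner_sum, Matrix.conjTranspose_apply,
    RealNormedDivisionAlgebra.star_mul_self, inner_smul_right, inner_one_one, mul_one]

theorem exp_neg_le_mul_one_add_rpow {s : ℝ} (hs : 0 ≤ s) (k : ℕ) :
    Real.exp (-s) ≤ Real.exp 1 * k.factorial * (1 + s) ^ (-(k : ℝ)) := by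
  have h := Real.pow_div_factorial_le_exp (1 + s) (by positivity) k
  rw [Real.exp_add, div_le_iff₀ (by positivity)] at h
  rw [Real.exp_neg, Real.rpow_neg (by positivity), Real.rpow_natCast, ← div_eq_mul_inv,
    inv_le_iff_one_le_mul₀ (Real.exp_pos s), div_mul_eq_mul_div, one_le_div (by positivity)]
  linarith

theorem IsPosDef.two_mul_norm_apply_le {A : Matrix (Fin n) (Fin n) F} (hA : IsPosDef A)
    (i j : Fin n) : 2 * ‖A i j‖ ≤ inner ℝ (1 : F) (A i i) + inner ℝ (1 : F) (A j j) := by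
  obtain ⟨u, rfl⟩ := hA.exists_eq_conjTranspose_mul_self
  rw [inner_one_conjTranspose_mul_self_apply_self, inner_one_conjTranspose_mul_self_apply_self,
    ← Finset.sum_add_distrib]
  have norm_apply_le : ‖(u.valᴴ * u.val) i j‖ ≤ ∑ k, ‖u.val k i‖ * ‖u.val k j‖ := by
    rw [Matrix.mul_apply]
    exact norm_sum_le_of_le _ fun k _ => by rw [norm_mul, Matrix.conjTranspose_apply, norm_star]
  calc 2 * ‖(u.valᴴ * u.val) i j‖ ≤ 2 * ∑ k, ‖u.val k i‖ * ‖u.val k j‖ := by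
        gcongr
    _ ≤ ∑ k, (‖u.val k i‖ ^ 2 + ‖u.val k j‖ ^ 2) := by
        rw [Finset.mul_sum]
        gcongr with k
        rw [← mul_assoc]
        exact two_mul_le_add_sq _ _

theorem norm_le_retr_hermOf {p : HermCoord F n} (hp : IsPosDef (hermOf p)) :
    ‖p‖ ≤ retr (hermOf p) := by
  have inner_diag (i : Fin n) : inner ℝ (1 : F) (hermOf p i i) = p.1 i := by
    rw [hermOf_diag, inner_smul_right, inner_one_one, mul_one]
  have diag_nonneg (i : Fin n) : 0 ≤ p.1 i := inner_diag i ▸ (hp.diag_pos i).le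
  have diag_le (i : Fin n) : p.1 i ≤ ∑ i, p.1 i :=
    Finset.single_le_sum (fun i _ => diag_nonneg i) (Finset.mem_univ i)
  have sum_nonneg : 0 ≤ ∑ i, p.1 i := Finset.sum_nonneg fun i _ => diag_nonneg i
  rw [retr_eq_sum, Finset.sum_congr rfl fun i _ => inner_diag i, Prod.norm_def]
  refine max_le ((pi_norm_le_iff_of_nonneg sum_nonneg).2 fun i => ?_)
    ((pi_norm_le_iff_of_nonneg sum_nonneg).2 fun q => ?_)
  · rw [Real.norm_of_nonneg (diag_nonneg i)]
    exact diag_le i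
  · have h := hp.two_mul_norm_apply_le q.1.1 q.1.2
    rw [hermOf_of_lt p q.2, inner_diag, inner_diag] at h
    linarith [diag_le q.1.1, diag_le q.1.2]

variable [FiniteDimensional ℝ F]

theorem detF_one_add_column_mul_conjTranspose (T : Matrix (Fin m) (Fin 1) F) :
    detF (1 + T * Tᴴ) = 1 + ∑ i, ‖T i 0‖ ^ 2 := by
  have pos : 0 < 1 + ∑ i, ‖T i 0‖ ^ 2 := by positivity
  have gram_eq : 1 + Tᴴ * T = (diagUnit F (fun _ : Fin 1 => 1 + ∑ i, ‖T i 0‖ ^ 2)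
      fun _ => pos.ne').val := by
    ext i j
    rw [Subsingleton.elim i 0, Subsingleton.elim j 0]
    simp only [diagUnit, Matrix.add_apply, Matrix.one_apply_eq, Matrix.mul_apply,
      Matrix.conjTranspose_apply, RealNormedDivisionAlgebra.star_mul_self,
      Matrix.diagonal_apply_eq, add_smul, one_smul, Finset.sum_smul]
  rw [detF_one_add_mul_comm, gram_eq, detF_diagUnit, Fin.prod_univ_one, abs_of_pos pos]

theorem one_add_norm_sq_le_detF_one_add_column (T : Fin m → Fin 1 → F) :
    1 + ‖T‖ ^ 2 ≤ detF (1 + Matrix.of T * (Matrix.of T)ᴴ) := by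
  rw [detF_one_add_column_mul_conjTranspose]
  gcongr
  have sum_nonneg : 0 ≤ ∑ i, ‖T i 0‖ ^ 2 := by positivity
  refine (Real.le_sqrt (norm_nonneg _) sum_nonneg).1 ?_
  refine (pi_norm_le_iff_of_nonneg (Real.sqrt_nonneg _)).2 fun i =>
    (pi_norm_le_iff_of_nonneg (Real.sqrt_nonneg _)).2 fun j => ?_
  rw [Subsingleton.elim j 0, Real.le_sqrt (norm_nonneg _) sum_nonneg]
  exact Finset.single_le_sum (f := fun i => ‖T i 0‖ ^ 2) (fun i _ => by positivity)
    (Finset.mem_univ i)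

variable [MeasurableSpace F] [BorelSpace F]

theorem lintegral_detF_one_add_column_lt_top {a : ℝ} (ha : rdim F * m / 2 < a) :
    ∫⁻ T : Matrix (Fin m) (Fin 1) F, ENNReal.ofReal (detF (1 + T * Tᴴ) ^ (-a))
      ∂matVolume F m 1 < ⊤ := by
  have ha_pos : 0 < a := lt_of_le_of_lt (by have := rdim_pos F; positivity) ha
  have finrank_lt : (Module.finrank ℝ (Fin m → Fin 1 → F) : ℝ) < 2 * a := by
    rw [rdim] at ha
    simp only [Module.finrank_pi_fintype, Finset.sum_const, Finset.card_univ, Fintype.card_fin,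
      smul_eq_mul, Nat.cast_mul, one_mul]
    linarith
  have integrable := integrable_rpow_neg_one_add_norm_sq
    (μ := (volume : Measure (Fin m → Fin 1 → F))) finrank_lt
  refine (lintegral_mono fun T => ENNReal.ofReal_le_ofReal ?_).trans_lt
    integrable.lintegral_lt_top
  rw [neg_div, mul_div_cancel_left₀ a two_ne_zero]
  exact Real.rpow_le_rpow_of_nonpos (by positivity) (one_add_norm_sq_le_detF_one_add_column T)
    (by linarith)

theorem lintegral_detF_add_conj_ne_zero {M : Matrix (Fin m) (Fin m) F} (hM : IsPosDef M)
    {N : Matrix (Fin n) (Fin n) F} (hN : IsPosDef N) (s : ℝ) :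
    ∫⁻ T, ENNReal.ofReal (detF (M + T * N * Tᴴ) ^ s) ∂matVolume F m n ≠ 0 := by
  have support_eq_univ : (Function.support fun T : Matrix (Fin m) (Fin n) F =>
      ENNReal.ofReal (detF (M + T * N * Tᴴ) ^ s)) = Set.univ := by
    refine Set.eq_univ_of_forall fun T => ?_
    have hMT : IsPosDef (M + T * N * Tᴴ) := by simpa using hM.add_conj hN Tᴴ
    exact (ENNReal.ofReal_pos.2 (Real.rpow_pos_of_pos hMT.detF_pos s)).ne'
  rw [← pos_iff_ne_zero, lintegral_pos_iff_support (measurable_ofReal_detF_add_conj M N s),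
    support_eq_univ]
  exact isOpen_univ.measure_pos (volume : Measure (Fin m → Fin n → F)) Set.univ_nonempty

theorem measurable_exp_neg_retr_mul_detF_rpow (a : ℝ) :
    Measurable fun V : Matrix (Fin n) (Fin n) F => Real.exp (-retr V) * detF V ^ a :=
  measurable_retr.neg.exp.mul (measurable_detF.pow_const a)

theorem lmvGamma_eq_setLIntegral (a : ℝ) :
    lmvGamma F n a = ∫⁻ V in {V | IsPosDef V}, ENNReal.ofReal (Real.exp (-retr V) *
      detF V ^ (a - ((n : ℝ) - 1) * rdim F / 2 - 1)) ∂hermVolume F n := by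
  rw [lmvGamma, lintegral_posDefMeasure]
  refine setLIntegral_congr_fun measurableSet_isPosDef fun V (hV : IsPosDef V) => ?_
  rw [← ENNReal.ofReal_mul (Real.rpow_nonneg (detF_nonneg V) _), mul_left_comm,
    ← Real.rpow_add hV.detF_pos]
  congr 3
  ring

theorem lmvGamma_eq_lintegral_hermOf (a : ℝ) :
    lmvGamma F n a = ∫⁻ p in {p : HermCoord F n | IsPosDef (hermOf p)}, ENNReal.ofReal
      (Real.exp (-retr (hermOf p)) *
        detF (hermOf p) ^ (a - ((n : ℝ) - 1) * rdim F / 2 - 1)) := by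
  rw [lmvGamma_eq_setLIntegral, ← lintegral_indicator measurableSet_isPosDef,
    lintegral_hermVolume, ← lintegral_indicator isOpen_isPosDef_hermOf.measurableSet]
  rfl

theorem lmvGamma_ne_zero (a : ℝ) : lmvGamma F n a ≠ 0 := by
  have measurable_integrand : Measurable fun p : HermCoord F n => ENNReal.ofReal
      (Real.exp (-retr (hermOf p)) *
        detF (hermOf p) ^ (a - ((n : ℝ) - 1) * rdim F / 2 - 1)) :=
    (measurable_exp_neg_retr_mul_detF_rpow _).ennreal_ofReal.comp
      measurableEmbedding_hermOf.measurable
  rw [lmvGamma_eq_lintegral_hermOf, ← pos_iff_ne_zero, setLIntegral_pos_iff measurable_integrand,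
    Set.inter_eq_self_of_subset_right]
  · refine isOpen_isPosDef_hermOf.measure_pos _ ⟨hermCoord F n 1, ?_⟩
    change IsPosDef _
    rw [hermOf_hermCoord isPosDef_one.1]
    exact isPosDef_one
  · intro p (hp : IsPosDef (hermOf p))
    have := hp.detF_pos
    exact (ENNReal.ofReal_pos.2 (by positivity)).ne'

variable (F n) in
theorem lmvGamma_base_lt_top : lmvGamma F n (((n : ℝ) - 1) * rdim F / 2 + 1) < ⊤ := by
  let k : ℕ := Module.finrank ℝ (HermCoord F n) + 1
  have integrable : Integrable fun p : HermCoord F n =>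
      Real.exp 1 * k.factorial * (1 + ‖p‖) ^ (-(k : ℝ)) :=
    (integrable_one_add_norm (by simp [k])).const_mul _
  rw [lmvGamma_eq_lintegral_hermOf]
  refine lt_of_le_of_lt ?_ integrable.lintegral_lt_top
  refine (setLIntegral_mono' isOpen_isPosDef_hermOf.measurableSet fun p hp =>
    ENNReal.ofReal_le_ofReal ?_).trans (setLIntegral_le_lintegral _ _)
  rw [add_sub_cancel_left, sub_self, Real.rpow_zero, mul_one]
  exact (Real.exp_le_exp.2 (neg_le_neg (norm_le_retr_hermOf hp))).trans
    (exp_neg_le_mul_one_add_rpow (norm_nonneg p) k)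

theorem lmvGamma_le_add {a b c : ℝ} (hab : a ≤ b) (hbc : b ≤ c) :
    lmvGamma F n b ≤ lmvGamma F n a + lmvGamma F n c := by
  rw [lmvGamma, lmvGamma, lmvGamma, ← lintegral_add_left
    (measurable_exp_neg_retr_mul_detF_rpow a).ennreal_ofReal]
  refine lintegral_mono_ae (ae_isPosDef_posDefMeasure.mono fun V hV => ?_)
  have detF_pos := hV.detF_pos
  rw [← ENNReal.ofReal_add (by positivity) (by positivity), ← mul_add]
  refine ENNReal.ofReal_le_ofReal (mul_le_mul_of_nonneg_left ?_ (Real.exp_pos _).le)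
  rcases le_total 1 (detF V) with one_le | le_one
  · exact le_add_of_nonneg_of_le (by positivity) (Real.rpow_le_rpow_of_exponent_le one_le hbc)
  · exact le_add_of_le_of_nonneg (Real.rpow_le_rpow_of_exponent_ge detF_pos le_one hab)
      (by positivity)

theorem lmvGamma_add_half_rdim_lt_top_iff {a : ℝ} (ha : ((m : ℝ) - 1) * rdim F / 2 < a) :
    lmvGamma F m (a + rdim F / 2) < ⊤ ↔ lmvGamma F m a < ⊤ := by
  have h := lmvGamma_mul_lintegral_detF_add_conj (isPosDef_one (F := F) (n := m))
    (isPosDef_one (F := F) (n := 1)) (a + rdim F / 2)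
  have integral_ne_zero := lintegral_detF_add_conj_ne_zero (isPosDef_one (F := F) (n := m))
    (isPosDef_one (F := F) (n := 1)) (-(a + rdim F / 2))
  simp only [Matrix.mul_one, detF_one, Real.one_rpow, mul_one, Nat.cast_one,
    add_sub_cancel_right] at h integral_ne_zero
  have integral_lt_top := lintegral_detF_one_add_column_lt_top (F := F) (m := m)
    (a := a + rdim F / 2) (by linarith)
  have pi_ne_zero : ENNReal.ofReal (Real.pi ^ (m * rdim F / 2)) ≠ 0 :=
    (ENNReal.ofReal_pos.2 (by positivity)).ne'
  constructor
  · intro lt_top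
    exact ENNReal.lt_top_of_mul_ne_top_right
      (h.symm.trans_lt (ENNReal.mul_lt_top lt_top integral_lt_top)).ne pi_ne_zero
  · intro lt_top
    exact ENNReal.lt_top_of_mul_ne_top_left
      (h.trans_lt (ENNReal.mul_lt_top ENNReal.ofReal_lt_top lt_top)).ne integral_ne_zero

theorem lmvGamma_add_mul_half_rdim_lt_top_iff {a : ℝ} (ha : ((m : ℝ) - 1) * rdim F / 2 < a)
    (k : ℕ) : lmvGamma F m (a + k * (rdim F / 2)) < ⊤ ↔ lmvGamma F m a < ⊤ := by
  induction k with
  | zero => simp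
  | succ k ih =>
    have := rdim_pos F
    rw [← ih, Nat.cast_add_one, add_one_mul, ← add_assoc]
    exact lmvGamma_add_half_rdim_lt_top_iff (lt_add_of_lt_of_nonneg ha (by positivity))

theorem lmvGamma_lt_top {a : ℝ} (ha : ((n : ℝ) - 1) * rdim F / 2 < a) : lmvGamma F n a < ⊤ := by
  have half_rdim_pos : 0 < rdim F / 2 := half_pos (rdim_pos F)
  let a₀ : ℝ := ((n : ℝ) - 1) * rdim F / 2 + 1
  obtain ⟨k, hk⟩ := exists_nat_ge ((a₀ - a) / (rdim F / 2))
  obtain ⟨l, hl⟩ := exists_nat_ge ((a + k * (rdim F / 2) - a₀) / (rdim F / 2))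
  rw [div_le_iff₀ half_rdim_pos, sub_le_iff_le_add'] at hk hl
  rw [← lmvGamma_add_mul_half_rdim_lt_top_iff ha k]
  refine (lmvGamma_le_add hk hl).trans_lt (ENNReal.add_lt_top.2 ⟨lmvGamma_base_lt_top F n, ?_⟩)
  exact (lmvGamma_add_mul_half_rdim_lt_top_iff (lt_add_one _) l).2 (lmvGamma_base_lt_top F n)

theorem mvGamma_eq_toReal_lmvGamma (a : ℝ) : mvGamma F n a = (lmvGamma F n a).toReal := by
  rw [mvGamma, lmvGamma_eq_setLIntegral, integral_eq_lintegral_of_nonneg_ae]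
  · exact .of_forall fun A =>
      mul_nonneg (Real.exp_pos _).le (Real.rpow_nonneg (detF_nonneg _) _)
  · exact (measurable_exp_neg_retr_mul_detF_rpow _).aestronglyMeasurable

theorem mvGamma_pos {a : ℝ} (ha : ((n : ℝ) - 1) * rdim F / 2 < a) : 0 < mvGamma F n a := by
  rw [mvGamma_eq_toReal_lmvGamma]
  exact ENNReal.toReal_pos (lmvGamma_ne_zero a) (lmvGamma_lt_top ha).ne

theorem ofReal_mvGamma {a : ℝ} (ha : ((n : ℝ) - 1) * rdim F / 2 < a) :
    ENNReal.ofReal (mvGamma F n a) = lmvGamma F n a := by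
  rw [mvGamma_eq_toReal_lmvGamma, ENNReal.ofReal_toReal (lmvGamma_lt_top ha).ne]

end GammaConvergence

section Inverse

theorem measurable_ringInverse_of_normedRing {R : Type*} [NormedRing R] [HasSummableGeomSeries R]
    [MeasurableSpace R] [BorelSpace R] : Measurable (Ring.inverse : R → R) := by
  classical
  have continuousOn_isUnit : ContinuousOn (Ring.inverse : R → R) {A | IsUnit A} := by
    rintro A ⟨u, rfl⟩
    exact (NormedRing.inverse_continuousAt u).continuousWithinAt
  have eq_piecewise : (Ring.inverse : R → R) = {A | IsUnit A}.piecewise Ring.inverse 0 := by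
    funext A
    by_cases hA : IsUnit A
    · rw [Set.piecewise_eq_of_mem _ _ _ (by exact hA)]
    · rw [Set.piecewise_eq_of_notMem _ _ _ (by exact hA), Ring.inverse_non_unit A hA,
        Pi.zero_apply]
  rw [eq_piecewise]
  exact continuousOn_isUnit.measurable_piecewise continuousOn_const Units.isOpen.measurableSet

variable {F : Type*} [NormedDivisionRing F] {n : ℕ}

theorem measurable_ringInverse [InnerProductSpace ℝ F] [FiniteDimensional ℝ F]
    [MeasurableSpace F] [BorelSpace F] :
    Measurable (Ring.inverse : Matrix (Fin n) (Fin n) F → Matrix (Fin n) (Fin n) F) := by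
  let normedRing : NormedRing (Matrix (Fin n) (Fin n) F) := Matrix.linftyOpNormedRing
  have : @BorelSpace _ normedRing.toMetricSpace.toUniformSpace.toTopologicalSpace
      (matrixMeasurableSpace (m := Fin n) (n := Fin n) (F := F)) :=
    inferInstanceAs (BorelSpace (Fin n → Fin n → F))
  have : @CompleteSpace (Matrix (Fin n) (Fin n) F) normedRing.toMetricSpace.toUniformSpace :=
    have := FiniteDimensional.complete ℝ F
    inferInstanceAs (CompleteSpace (Fin n → Fin n → F))
  exact @measurable_ringInverse_of_normedRing _ normedRing inferInstance _ ‹_›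

theorem measurable_mul_inverse_add [InnerProductSpace ℝ F] [FiniteDimensional ℝ F]
    [MeasurableSpace F] [BorelSpace F] {m : ℕ} (μ : Matrix (Fin m) (Fin n) F) :
    Measurable fun z : Matrix (Fin n) (Fin n) F × Matrix (Fin m) (Fin n) F =>
      z.2 * Ring.inverse z.1 + μ := by
  have continuous_mul_add : Continuous fun z : Matrix (Fin n) (Fin n) F ×
      Matrix (Fin m) (Fin n) F => z.2 * z.1 + μ := by fun_prop
  exact continuous_mul_add.measurable.comp
    ((measurable_ringInverse.comp measurable_fst).prodMk measurable_snd)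

theorem inverse_mul_conjTranspose_self [StarRing F] (L : (Matrix (Fin n) (Fin n) F)ˣ) :
    Ring.inverse (L.val * L.valᴴ) = (L⁻¹).valᴴ * (L⁻¹).val :=
  Ring.inverse_unit (L * star L)

theorem isUnit_of_isPosDef_mul_conjTranspose [StarRing F] [InnerProductSpace ℝ F]
    [RealNormedDivisionAlgebra F] [FiniteDimensional ℝ F] {L : Matrix (Fin n) (Fin n) F}
    (h : IsPosDef (L * Lᴴ)) : IsUnit L := by
  obtain ⟨B, hB⟩ := h.isUnit.exists_right_inv
  rw [Matrix.mul_assoc] at hB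
  exact IsUnit.of_mul_eq_one _ hB

end Inverse

section Laws

variable {F : Type*} [NormedDivisionRing F] [StarRing F] [InnerProductSpace ℝ F]
  [RealNormedDivisionAlgebra F] {m n : ℕ}

/-- The density of the matrix normal law `N_{m×n}^β(M, A ⊗ B)`. -/
def matrixNormalPDF (M : Matrix (Fin m) (Fin n) F) (A : Matrix (Fin m) (Fin m) F)
    (B : Matrix (Fin n) (Fin n) F) (Y : Matrix (Fin m) (Fin n) F) : ℝ :=
  1 / ((2 * Real.pi / rdim F) ^ (rdim F * m * n / 2)
      * detF A ^ (rdim F * n / 2) * detF B ^ (rdim F * m / 2))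
    * Real.exp (-(rdim F / 2 * retr (Ring.inverse A * (Y - M) * Ring.inverse B * (Y - M)ᴴ)))

theorem exists_matrixNormalPDF_inverse {Ξ : Matrix (Fin m) (Fin m) F} (hΞ : IsUnit Ξ)
    (μ : Matrix (Fin m) (Fin n) F) : ∃ c : ℝ, ∀ T {V : Matrix (Fin n) (Fin n) F}, IsPosDef V →
      matrixNormalPDF μ (Ring.inverse Ξ) (Ring.inverse V) T = c *
        (Real.exp (-(rdim F / 2 * retr ((T - μ)ᴴ * Ξ * (T - μ) * V))) *
          detF V ^ (rdim F * m / 2)) := by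
  refine ⟨1 / ((2 * Real.pi / rdim F) ^ (rdim F * m * n / 2) *
    detF (Ring.inverse Ξ) ^ (rdim F * n / 2)), fun T V hV => ?_⟩
  rw [matrixNormalPDF, Ring.inverse_inverse hΞ, Ring.inverse_inverse hV.isUnit,
    detF_inverse hV.isUnit, Real.inv_rpow hV.detF_pos.le, retr_mul_comm]
  simp only [Matrix.mul_assoc]
  field_simp

variable [FiniteDimensional ℝ F]

theorem detF_add_conj_comm {Ξ : Matrix (Fin m) (Fin m) F} (hΞ : IsUnit Ξ)
    {S : Matrix (Fin n) (Fin n) F} (hS : IsUnit S) (T : Matrix (Fin m) (Fin n) F) :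
    detF (S + Tᴴ * Ξ * T)
      = detF S * detF Ξ * detF (Ring.inverse Ξ + T * Ring.inverse S * Tᴴ) := by
  have factor_S : S + Tᴴ * Ξ * T = S * (1 + (Ring.inverse S * Tᴴ) * (Ξ * T)) := by
    rw [Matrix.mul_add, Matrix.mul_one]
    simp only [← Matrix.mul_assoc]
    rw [Ring.mul_inverse_cancel _ hS, Matrix.one_mul]
  have factor_Ξ : 1 + (Ξ * T) * (Ring.inverse S * Tᴴ)
      = Ξ * (Ring.inverse Ξ + T * Ring.inverse S * Tᴴ) := by
    rw [Matrix.mul_add, Ring.mul_inverse_cancel _ hΞ]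
    simp only [Matrix.mul_assoc]
  rw [factor_S, detF_mul, detF_one_add_mul_comm, factor_Ξ, detF_mul, mul_assoc]

theorem matrixNormalPDF_mul_add (M μ : Matrix (Fin m) (Fin n) F) (A : Matrix (Fin m) (Fin m) F)
    {B : Matrix (Fin n) (Fin n) F} (hB : IsUnit B) (C : (Matrix (Fin n) (Fin n) F)ˣ)
    (Y : Matrix (Fin m) (Fin n) F) :
    detF C.val ^ (rdim F * m) *
        matrixNormalPDF (M * C.val + μ) A (C.valᴴ * B * C.val) (Y * C.val + μ)
      = matrixNormalPDF M A B Y := by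
  obtain ⟨B, rfl⟩ := hB
  have hC := detF_pos_of_isUnit C.isUnit
  have inverse_conj : Ring.inverse (C.valᴴ * B.val * C.val)
      = (C⁻¹).val * (B⁻¹).val * (C⁻¹).valᴴ := by
    simpa [mul_assoc, Matrix.star_eq_conjTranspose] using Ring.inverse_unit (star C * B * C)
  have residual_conj : (Y * C.val + μ - (M * C.val + μ)) * (C⁻¹).val = Y - M := by
    rw [add_sub_add_right_eq_sub, ← Matrix.sub_mul, Matrix.mul_assoc, Units.mul_inv,
      Matrix.mul_one]
  have quadratic_form_eq : Ring.inverse A * (Y * C.val + μ - (M * C.val + μ)) *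
        Ring.inverse (C.valᴴ * B.val * C.val) * (Y * C.val + μ - (M * C.val + μ))ᴴ
      = Ring.inverse A * (Y - M) * Ring.inverse B.val * (Y - M)ᴴ := by
    rw [inverse_conj, Ring.inverse_unit, ← residual_conj, Matrix.conjTranspose_mul]
    simp only [Matrix.mul_assoc]
  have detF_conj_rpow : detF (C.valᴴ * B.val * C.val) ^ (rdim F * m / 2)
      = detF C.val ^ (rdim F * m) * detF B.val ^ (rdim F * m / 2) := by
    have detF_conj_eq : detF (C.valᴴ * B.val * C.val) = detF (C.valᴴ * C.val) * detF B.val := by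
      simp only [detF_mul]
      ring
    rw [detF_conj_eq, Real.mul_rpow (detF_nonneg _) (detF_nonneg _),
      detF_conjTranspose_mul_self_rpow, mul_div_cancel₀ _ two_ne_zero]
  rw [matrixNormalPDF, matrixNormalPDF, quadratic_form_eq, detF_conj_rpow]
  field_simp

variable [MeasurableSpace F] [BorelSpace F]

theorem measurable_matrixNormalPDF (M : Matrix (Fin m) (Fin n) F) (A : Matrix (Fin m) (Fin m) F) :
    Measurable fun z : Matrix (Fin n) (Fin n) F × Matrix (Fin m) (Fin n) F =>
      matrixNormalPDF M A z.1 z.2 := by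
  have continuous_form : Continuous fun z : Matrix (Fin n) (Fin n) F × Matrix (Fin m) (Fin n) F =>
      Ring.inverse A * (z.2 - M) * z.1 * (z.2 - M)ᴴ := by fun_prop
  have measurable_form := continuous_form.measurable.comp
    ((measurable_ringInverse.comp measurable_fst).prodMk measurable_snd)
  exact ((((measurable_detF.comp measurable_fst).pow_const _).const_mul _).const_div 1).mul
    ((measurable_retr.comp measurable_form).const_mul _).neg.exp

theorem measurable_matrixNormal (M : Matrix (Fin m) (Fin n) F) (A : Matrix (Fin m) (Fin m) F) :
    Measurable (matrixNormal M A) := by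
  refine Measure.measurable_of_measurable_coe _ fun E hE => ?_
  simp_rw [matrixNormal, withDensity_apply _ hE]
  exact (measurable_matrixNormalPDF M A).ennreal_ofReal.lintegral_prod_right'

theorem map_mul_add_matrixNormal (M μ : Matrix (Fin m) (Fin n) F) (A : Matrix (Fin m) (Fin m) F)
    {B : Matrix (Fin n) (Fin n) F} (hB : IsUnit B) (C : (Matrix (Fin n) (Fin n) F)ˣ) :
    (matrixNormal M A B).map (fun Y : Matrix (Fin m) (Fin n) F => Y * C.val + μ)
      = matrixNormal (M * C.val + μ) A (C.valᴴ * B * C.val) := by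
  have lintegral_eq (M : Matrix (Fin m) (Fin n) F) (B : Matrix (Fin n) (Fin n) F)
      (f : Matrix (Fin m) (Fin n) F → ENNReal) : ∫⁻ Y, f Y ∂matrixNormal M A B
        = ∫⁻ Y, ENNReal.ofReal (matrixNormalPDF M A B Y) * f Y ∂matVolume F m n :=
    lintegral_withDensity_eq_lintegral_mul_non_measurable _
      ((measurable_matrixNormalPDF M A).comp measurable_prodMk_left).ennreal_ofReal
      (.of_forall fun _ => ENNReal.ofReal_lt_top) f
  refine Measure.ext_of_lintegral _ fun f hf => ?_
  rw [eq_comm, lintegral_map hf (Continuous.measurable (by fun_prop)), lintegral_eq,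
    ← lintegral_matVolume_sub (-μ), ← lintegral_matVolume_mul_right C.isUnit, lintegral_eq,
    ← lintegral_const_mul' _ _ ENNReal.ofReal_ne_top]
  refine lintegral_congr fun Y => ?_
  rw [sub_neg_eq_add, ← mul_assoc, ← ENNReal.ofReal_mul (Real.rpow_nonneg (detF_nonneg _) _),
    matrixNormalPDF_mul_add M μ A hB]

theorem ae_isPosDef_wishart (N : ℝ) (S : Matrix (Fin n) (Fin n) F) :
    ∀ᵐ V ∂wishart N S, IsPosDef V :=
  (withDensity_absolutelyContinuous _ _).ae_le (ae_restrict_mem measurableSet_isPosDef)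

theorem exists_lintegral_wishart (N : ℝ) (S : Matrix (Fin n) (Fin n) F) :
    ∃ c : ENNReal, ∀ f : Matrix (Fin n) (Fin n) F → ENNReal,
      ∫⁻ V, f V ∂wishart N S = c * ∫⁻ V, ENNReal.ofReal
        (Real.exp (-(rdim F / 2 * retr (Ring.inverse S * V))) * detF V ^ (rdim F * N / 2)) * f V
          ∂posDefMeasure F n := by
  refine ⟨ENNReal.ofReal (1 / ((2 / rdim F) ^ (rdim F * n * N / 2) *
    mvGamma F n (rdim F * N / 2) * detF S ^ (rdim F * N / 2))), fun f => ?_⟩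
  have measurable_exp : Measurable fun V : Matrix (Fin n) (Fin n) F =>
      Real.exp (-(rdim F / 2 * retr (Ring.inverse S * V))) :=
    ((measurable_retr.comp (Continuous.measurable (by fun_prop))).const_mul _).neg.exp
  refine (lintegral_withDensity_eq_lintegral_mul_non_measurable _
    (((measurable_detF.pow_const _).const_mul _).mul measurable_exp).ennreal_ofReal
    (.of_forall fun _ => ENNReal.ofReal_lt_top) f).trans ?_
  rw [lintegral_posDefMeasure, ← lintegral_const_mul' _ _ ENNReal.ofReal_ne_top]
  refine setLIntegral_congr_fun measurableSet_isPosDef fun V hV => ?_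
  have hV : 0 < detF V := IsPosDef.detF_pos hV
  have exponent_eq : rdim F * (N - n + 1) / 2 - 1
      = -(((n : ℝ) - 1) * rdim F / 2 + 1) + rdim F * N / 2 := by ring
  simp only [Pi.mul_apply]
  rw [← mul_assoc, ← mul_assoc, ← ENNReal.ofReal_mul' (by positivity),
    ← ENNReal.ofReal_mul' (by positivity), exponent_eq, Real.rpow_add hV]
  congr 2
  ring

/-- The law `T_{m×n}^β(ν, μ, Ξ, S)` without its normalizing constant, where `a = β (n + ν) / 2`. -/
def unnormalizedT (a : ℝ) (μ : Matrix (Fin m) (Fin n) F) (Ξ : Matrix (Fin m) (Fin m) F)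
    (S : Matrix (Fin n) (Fin n) F) : Measure (Matrix (Fin m) (Fin n) F) :=
  (matVolume F m n).withDensity fun T => ENNReal.ofReal
    (detF (Ring.inverse Ξ + (T - μ) * Ring.inverse S * (T - μ)ᴴ) ^ (-a))

theorem exists_lintegral_matrixNormalPDF_wishart {Ξ : Matrix (Fin m) (Fin m) F} (hΞ : IsPosDef Ξ)
    {S : Matrix (Fin n) (Fin n) F} (hS : IsPosDef S) (N : ℝ) (μ : Matrix (Fin m) (Fin n) F) :
    ∃ c : ENNReal, ∀ T, ∫⁻ V, ENNReal.ofReal (matrixNormalPDF μ (Ring.inverse Ξ) (Ring.inverse V) T)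
        ∂wishart N (Ring.inverse S)
      = c * ENNReal.ofReal (detF (Ring.inverse Ξ + (T - μ) * Ring.inverse S * (T - μ)ᴴ)
          ^ (-(rdim F * (N + m) / 2))) := by
  obtain ⟨cW, hW⟩ := exists_lintegral_wishart N (Ring.inverse S)
  obtain ⟨cN, hN⟩ := exists_matrixNormalPDF_inverse hΞ.isUnit μ (n := n)
  set a := rdim F * (N + m) / 2
  have hβ := half_pos (rdim_pos F)
  let κ := detF ((rdim F / 2) • (1 : Matrix (Fin n) (Fin n) F)) * (detF S * detF Ξ)
  refine ⟨cW * (ENNReal.ofReal cN * (ENNReal.ofReal (κ ^ (-a)) * lmvGamma F n a)), fun T => ?_⟩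
  let A := (rdim F / 2) • (S + (T - μ)ᴴ * Ξ * (T - μ))
  have hA : IsPosDef A := (hS.add_conj hΞ (T - μ)).smul hβ
  have detF_A : detF A = κ * detF (Ring.inverse Ξ + (T - μ) * Ring.inverse S * (T - μ)ᴴ) := by
    rw [show A = ((rdim F / 2) • (1 : Matrix _ _ F)) * (S + (T - μ)ᴴ * Ξ * (T - μ)) by
      rw [Matrix.smul_mul, Matrix.one_mul], detF_mul, detF_add_conj_comm hΞ.isUnit hS.isUnit]
    ring
  have integrand_eq {V : Matrix (Fin n) (Fin n) F} (hV : IsPosDef V) :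
      ENNReal.ofReal (Real.exp (-(rdim F / 2 * retr (Ring.inverse (Ring.inverse S) * V))) *
          detF V ^ (rdim F * N / 2)) *
        ENNReal.ofReal (matrixNormalPDF μ (Ring.inverse Ξ) (Ring.inverse V) T)
      = ENNReal.ofReal cN * ENNReal.ofReal (Real.exp (-retr (A * V)) * detF V ^ a) := by
    have := hV.detF_pos
    have exponent_eq : a = rdim F * N / 2 + rdim F * m / 2 := by ring
    rw [hN T hV, Ring.inverse_inverse hS.isUnit, ENNReal.ofReal_mul' (p := cN) (by positivity),
      mul_left_comm, ← ENNReal.ofReal_mul (by positivity), Matrix.smul_mul, retr_smul,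
      Matrix.add_mul, retr_add, mul_add, neg_add, Real.exp_add, exponent_eq, Real.rpow_add this,
      mul_mul_mul_comm]
  rw [hW, lintegral_congr_ae (ae_isPosDef_posDefMeasure.mono fun V => integrand_eq),
    lintegral_const_mul' _ _ ENNReal.ofReal_ne_top, lintegral_exp_neg_retr_mul hA, detF_A,
    Real.mul_rpow (mul_nonneg (detF_nonneg _) (mul_nonneg (detF_nonneg _) (detF_nonneg _)))
      (detF_nonneg _), ENNReal.ofReal_mul' (Real.rpow_nonneg (detF_nonneg _) _)]
  ring

instance (N : ℝ) (S : Matrix (Fin n) (Fin n) F) : SFinite (wishart N S) :=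
  inferInstanceAs (SFinite (Measure.withDensity _ _))

theorem measurable_ofReal_detF_add_conj_sub (μ : Matrix (Fin m) (Fin n) F)
    (M : Matrix (Fin m) (Fin m) F) (N : Matrix (Fin n) (Fin n) F) (s : ℝ) : Measurable fun T =>
      ENNReal.ofReal (detF (M + (T - μ) * N * (T - μ)ᴴ) ^ s) :=
  (measurable_ofReal_detF_add_conj M N s).comp (Continuous.measurable (by fun_prop))

theorem exists_lintegral_matrixNormal_wishart {Ξ : Matrix (Fin m) (Fin m) F} (hΞ : IsPosDef Ξ)
    {S : Matrix (Fin n) (Fin n) F} (hS : IsPosDef S) (N : ℝ) (μ : Matrix (Fin m) (Fin n) F) :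
    ∃ c : ENNReal, ∀ E, MeasurableSet E →
      ∫⁻ V, matrixNormal μ (Ring.inverse Ξ) (Ring.inverse V) E ∂wishart N (Ring.inverse S)
        = (c • unnormalizedT (rdim F * (N + m) / 2) μ Ξ S) E := by
  obtain ⟨c, hc⟩ := exists_lintegral_matrixNormalPDF_wishart hΞ hS N μ
  refine ⟨c, fun E hE => ?_⟩
  have measurable_pdf : Measurable fun z : Matrix (Fin n) (Fin n) F × Matrix (Fin m) (Fin n) F =>
      ENNReal.ofReal (matrixNormalPDF μ (Ring.inverse Ξ) (Ring.inverse z.1) z.2) :=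
    ((measurable_matrixNormalPDF μ _).comp
      ((measurable_ringInverse.comp measurable_fst).prodMk measurable_snd)).ennreal_ofReal
  calc ∫⁻ V, matrixNormal μ (Ring.inverse Ξ) (Ring.inverse V) E ∂wishart N (Ring.inverse S)
    _ = ∫⁻ V, ∫⁻ T in E, ENNReal.ofReal (matrixNormalPDF μ (Ring.inverse Ξ) (Ring.inverse V) T)
          ∂matVolume F m n ∂wishart N (Ring.inverse S) :=
        lintegral_congr fun V => withDensity_apply _ hE
    _ = ∫⁻ T in E, c * ENNReal.ofReal (detF (Ring.inverse Ξ +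
          (T - μ) * Ring.inverse S * (T - μ)ᴴ) ^ (-(rdim F * (N + m) / 2))) ∂matVolume F m n := by
        rw [lintegral_lintegral_swap measurable_pdf.aemeasurable]
        simp_rw [hc]
    _ = (c • unnormalizedT (rdim F * (N + m) / 2) μ Ξ S) E := by
        rw [lintegral_const_mul _ (measurable_ofReal_detF_add_conj_sub μ _ _ _), unnormalizedT,
          Measure.smul_apply, withDensity_apply _ hE, smul_eq_mul]

theorem matricvariateT_eq_smul (ν : ℝ) (μ : Matrix (Fin m) (Fin n) F)
    (Ξ : Matrix (Fin m) (Fin m) F) (S : Matrix (Fin n) (Fin n) F) :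
    matricvariateT ν μ Ξ S = ENNReal.ofReal (mvGamma F m (rdim F * (n + ν) / 2)
        / (Real.pi ^ (m * n * rdim F / 2) * mvGamma F m (rdim F * ν / 2)
          * detF Ξ ^ (rdim F * ν / 2) * detF S ^ (rdim F * m / 2))) •
      unnormalizedT (rdim F * (n + ν) / 2) μ Ξ S := by
  rw [unnormalizedT, ← withDensity_smul _ (measurable_ofReal_detF_add_conj_sub _ _ _ _),
    matricvariateT]
  congr 1 with T
  exact ENNReal.ofReal_mul' (Real.rpow_nonneg (detF_nonneg _) _)

theorem ofReal_mvGamma_mul_unnormalizedT_univ {a : ℝ}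
    (ha : ((m : ℝ) - 1) * rdim F / 2 < a - rdim F * n / 2)
    (μ : Matrix (Fin m) (Fin n) F) {Ξ : Matrix (Fin m) (Fin m) F} (hΞ : IsPosDef Ξ)
    {S : Matrix (Fin n) (Fin n) F} (hS : IsPosDef S) :
    ENNReal.ofReal (mvGamma F m a) * unnormalizedT a μ Ξ S Set.univ
      = ENNReal.ofReal (Real.pi ^ (m * n * rdim F / 2) * mvGamma F m (a - rdim F * n / 2)
          * detF Ξ ^ (a - rdim F * n / 2) * detF S ^ (rdim F * m / 2)) := by
  have hdΞ := hΞ.detF_pos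
  have hdS := hS.detF_pos
  have hβ := rdim_pos F
  have ha' : ((m : ℝ) - 1) * rdim F / 2 < a := ha.trans_le (sub_le_self _ (by positivity))
  rw [unnormalizedT, withDensity_apply _ .univ, Measure.restrict_univ, lintegral_matVolume_sub μ
      fun T => ENNReal.ofReal (detF (Ring.inverse Ξ + T * Ring.inverse S * Tᴴ) ^ (-a)),
    ofReal_mvGamma ha', lmvGamma_mul_lintegral_detF_add_conj hΞ.inverse hS.inverse,
    ← ofReal_mvGamma ha, ← ENNReal.ofReal_mul' (mvGamma_pos ha).le, detF_inverse hΞ.isUnit,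
    detF_inverse hS.isUnit, Real.inv_rpow hdS.le, Real.inv_rpow hdΞ.le, Real.rpow_neg hdS.le,
    Real.rpow_neg hdΞ.le, inv_inv, inv_inv]
  congr 1
  ring

theorem isProbabilityMeasure_matricvariateT {ν : ℝ} (hν : (m : ℝ) - 1 < ν)
    (μ : Matrix (Fin m) (Fin n) F) {Ξ : Matrix (Fin m) (Fin m) F} (hΞ : IsPosDef Ξ)
    {S : Matrix (Fin n) (Fin n) F} (hS : IsPosDef S) :
    IsProbabilityMeasure (matricvariateT ν μ Ξ S) := by
  have hβ := rdim_pos F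
  have hdΞ := hΞ.detF_pos
  have hdS := hS.detF_pos
  have exponent_eq : rdim F * (n + ν) / 2 - rdim F * n / 2 = rdim F * ν / 2 := by ring
  have hν' : ((m : ℝ) - 1) * rdim F / 2 < rdim F * ν / 2 := by
    rw [mul_comm]
    gcongr
  have hΓ := mvGamma_pos hν'
  have mass := ofReal_mvGamma_mul_unnormalizedT_univ (n := n) (exponent_eq ▸ hν') μ hΞ hS
  rw [exponent_eq] at mass
  refine ⟨?_⟩
  rw [matricvariateT_eq_smul, Measure.smul_apply, smul_eq_mul, div_eq_inv_mul,
    ENNReal.ofReal_mul (by positivity), mul_assoc, mass, ← ENNReal.ofReal_mul (by positivity),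
    inv_mul_cancel₀ (by positivity), ENNReal.ofReal_one]

theorem smul_eq_smul_of_isProbabilityMeasure {α : Type*} [MeasurableSpace α] (κ : Measure α)
    (c d : ENNReal) [IsProbabilityMeasure (c • κ)] [IsProbabilityMeasure (d • κ)] :
    c • κ = d • κ := by
  have hc : c * κ Set.univ = 1 := measure_univ (μ := c • κ)
  have hd : d * κ Set.univ = 1 := measure_univ (μ := d • κ)
  congr 1
  calc c = c * (d * κ Set.univ) := by rw [hd, mul_one]
    _ = d * (c * κ Set.univ) := by ring
    _ = d := by rw [hc, mul_one]

end Laws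

section Representation

variable {F : Type*} [NormedDivisionRing F] [StarRing F] [InnerProductSpace ℝ F]
  [RealNormedDivisionAlgebra F] [FiniteDimensional ℝ F] [MeasurableSpace F] [BorelSpace F]
  {m n : ℕ}

theorem map_mul_inverse_add_matrixNormal (μ : Matrix (Fin m) (Fin n) F)
    (A : Matrix (Fin m) (Fin m) F) {L : Matrix (Fin n) (Fin n) F} (hL : IsUnit L) :
    (matrixNormal 0 A 1).map (fun Y : Matrix (Fin m) (Fin n) F => Y * Ring.inverse L + μ)
      = matrixNormal μ A (Ring.inverse (L * Lᴴ)) := by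
  obtain ⟨u, rfl⟩ := hL
  rw [Ring.inverse_unit, map_mul_add_matrixNormal 0 μ A isUnit_one, Matrix.zero_mul, zero_add,
    Matrix.mul_one, inverse_mul_conjTranspose_self]

theorem map_apply_of_indepFun {Ω α β γ : Type*} [MeasurableSpace Ω] [MeasurableSpace α]
    [MeasurableSpace β] [MeasurableSpace γ] {P : Measure Ω} [IsFiniteMeasure P] {L : Ω → α}
    {X : Ω → β} (hL : AEMeasurable L P) (hX : AEMeasurable X P) (hind : IndepFun L X P)
    {g : α × β → γ} (hg : Measurable g) {E : Set γ} (hE : MeasurableSet E) :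
    P.map (fun ω => g (L ω, X ω)) E = ∫⁻ ω, (P.map X).map (fun x => g (L ω, x)) E ∂P := by
  have hgE := hg hE
  rw [← Function.comp_def g, ← AEMeasurable.map_map_of_aemeasurable hg.aemeasurable
    (hL.prodMk hX), (indepFun_iff_map_prod_eq_prod_map_map hL hX).1 hind, Measure.map_apply hg hE,
    Measure.prod_apply hgE, lintegral_map' (measurable_measure_prodMk_left hgE).aemeasurable hL]
  refine lintegral_congr fun ω => ?_
  exact (Measure.map_apply (hg.comp measurable_prodMk_left) hE).symm

theorem map_mul_inverse_add_apply {Ω : Type*} [MeasurableSpace Ω] {P : Measure Ω}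
    [IsFiniteMeasure P] {A : Matrix (Fin m) (Fin m) F} {W : Measure (Matrix (Fin n) (Fin n) F)}
    (hW : ∀ᵐ V ∂W, IsPosDef V) {X : Ω → Matrix (Fin m) (Fin n) F}
    (hX : HasLaw X (matrixNormal 0 A 1) P) {U L : Ω → Matrix (Fin n) (Fin n) F}
    (hU : HasLaw U W P) (hL : AEMeasurable L P) (hLU : ∀ᵐ ω ∂P, L ω * (L ω)ᴴ = U ω)
    (hind : IndepFun L X P) (μ : Matrix (Fin m) (Fin n) F) {E : Set (Matrix (Fin m) (Fin n) F)}
    (hE : MeasurableSet E) :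
    P.map (fun ω => X ω * Ring.inverse (L ω) + μ) E
      = ∫⁻ V, matrixNormal μ A (Ring.inverse V) E ∂W := by
  have posDef_U : ∀ᵐ ω ∂P, IsPosDef (U ω) :=
    (hU.ae_iff (measurableSet_setOfPred.1 measurableSet_isPosDef)).2 hW
  have measurable_normal : Measurable fun V => matrixNormal μ A (Ring.inverse V) E :=
    (Measure.measurable_coe hE).comp ((measurable_matrixNormal μ A).comp measurable_ringInverse)
  rw [map_apply_of_indepFun hL hX.aemeasurable hind (measurable_mul_inverse_add μ) hE, hX.map_eq,
    ← hU.lintegral_comp measurable_normal.aemeasurable]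
  refine lintegral_congr_ae ?_
  filter_upwards [hLU, posDef_U] with ω hω hV
  rw [map_mul_inverse_add_matrixNormal μ A (isUnit_of_isPosDef_mul_conjTranspose (hω ▸ hV)), hω]

end Representation

end NDA

end

theorem mainTheorem2
    {F : Type*} [NormedDivisionRing F] [StarRing F] [InnerProductSpace ℝ F]
    [NDA.RealNormedDivisionAlgebra F] [FiniteDimensional ℝ F] [MeasurableSpace F] [BorelSpace F]
    {Ω : Type*} [MeasurableSpace Ω] (P : Measure Ω) [IsProbabilityMeasure P]
    {m n : ℕ} (ν : ℝ) (hν : (m : ℝ) - 1 < ν)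
    (μ : Matrix (Fin m) (Fin n) F)
    (Ξ : Matrix (Fin m) (Fin m) F) (hΞ : NDA.IsPosDef Ξ)
    (S : Matrix (Fin n) (Fin n) F) (hS : NDA.IsPosDef S)
    (X : Ω → Matrix (Fin m) (Fin n) F)
    (hX : HasLaw X (NDA.matrixNormal 0 (Ring.inverse Ξ) 1) P)
    (U : Ω → Matrix (Fin n) (Fin n) F)
    (hU : HasLaw U (NDA.wishart (ν + n - m) (Ring.inverse S)) P)
    (L₁ : Ω → Matrix (Fin n) (Fin n) F) (hL₁ : AEMeasurable L₁ P)
    (hL₁U : ∀ᵐ ω ∂P, L₁ ω * (L₁ ω)ᴴ = U ω)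
    (hind : IndepFun L₁ X P) :
    HasLaw (fun ω => X ω * Ring.inverse (L₁ ω) + μ) (NDA.matricvariateT ν μ Ξ S) P := by
  have aemeasurable_T : AEMeasurable (fun ω => X ω * Ring.inverse (L₁ ω) + μ) P :=
    (NDA.measurable_mul_inverse_add μ).comp_aemeasurable
      (f := fun ω => (L₁ ω, X ω)) (hL₁.prodMk hX.aemeasurable)
  refine ⟨aemeasurable_T, ?_⟩
  obtain ⟨c, hc⟩ := NDA.exists_lintegral_matrixNormal_wishart hΞ hS (ν + n - m) μ
  rw [sub_add_cancel] at hc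
  have law_eq : P.map (fun ω => X ω * Ring.inverse (L₁ ω) + μ)
      = c • NDA.unnormalizedT (NDA.rdim F * (n + ν) / 2) μ Ξ S := by
    ext E hE
    rw [NDA.map_mul_inverse_add_apply (NDA.ae_isPosDef_wishart _ _) hX hU hL₁ hL₁U hind μ hE,
      hc E hE, add_comm ν]
  have law_prob := Measure.isProbabilityMeasure_map (μ := P) aemeasurable_T
  have matricvariateT_prob := NDA.isProbabilityMeasure_matricvariateT hν μ hΞ hS
  rw [law_eq] at law_prob
  rw [NDA.matricvariateT_eq_smul] at matricvariateT_prob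
  rw [law_eq, NDA.matricvariateT_eq_smul]
  exact NDA.smul_eq_smul_of_isProbabilityMeasure _ _ _
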